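/- Consider the Rule 54 cellular automaton on the infinite lattice $\mathbb Z$: a configuration is $s\in\{0,1\}^{\mathbb Z}$, the local rule is $\chi(a,b,c)=a+b+c+ac \pmod 2$, and an even (odd) half-step $U_{\mathrm e}$ ($U_{\mathrm o}$) replaces $s_x$ by $\chi(s_{x-1},s_x,s_{x+1})$ at all even (odd) sites $x$ and keeps the other sites. Time evolution $U(t)$ consists of the first $t$ half-steps of the alternating sequence $U_{\mathrm e},U_{\mathrm o},U_{\mathrm e},\dots$ (in the first time-step the even sites are updated). For $k\in\mathbb Z$ let $\mathbf p^{(k)}$ be the product state in which the sites $y\le k$ are independent and uniform on $\{0,1\}$ and all sites $y>k$ are empty. Let $\tilde\rho(x,t)$ be the probability that $s_x=1$ after $t$ time-steps from the initial state $\mathbf p^{(0)}$ (a maximum-entropy half-chain joined to an empty half-chain). Let $\rho(t)$ be the observable defined by $\rho(0)(s)=s_0$ and $\rho(t+1)=\rho(t)\circ U_{\mathrm e}$ for even $t$, $\rho(t+1)=\rho(t)\circ U_{\mathrm o}$ for odd $t$, and let $r(m,t)$ be the expectation value of $\rho(t)$ in $\mathbf p^{(2m-t-1)}$. Then, for integers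 $x,m$ and integers $t\ge 0$: 1. $\tilde\rho(x,t)=r(\tfrac{t-x+1}{2},t)$ if $x+t$ is odd, and $\tilde\rho(x,t)=r(\tfrac{t-x}{2},t-1)$ if $x+t$ is even and $t\ge1$. 2. $\tilde\rho(x,t)=\tfrac12$ for $x<-t$ and $\tilde\rho(x,t)=0$ for $x>t$. 3. For $1\le m\le t$, $$\begin{aligned} r(m,t)={}&\tfrac38\delta_{m,t}+\tfrac18(\delta_{m,1}\delta_{t,1}+\delta_{m,2}\delta_{t,2})+\tfrac14\delta_{m,3}\delta_{t,4}+\theta_{2m-t-3}\,2^{t-2m-1}\binom{2m-t-3}{t-m-1}\\ &+\tfrac18\sum_{y=t-m-2}^{2m-t-3}2^{-(2m-t-3)}\binom{2m-t-3}{y}+\tfrac3{16}\sum_{y=0}^{2m-t-3}2^{-y}\binom{y}{t-m-1}\\ &+\tfrac12\sum_{y=0}^{t-m-1}2^{-(m-1-y)}\binom{m-1-y}{y},\end{aligned}$$ where $\theta_j=1$ for $j\ge0$ and $\theta_j=0$ for $j<0$, $\binom nk=0$ unless $0\le k\le n$, and a sum whose upper limit is below its lower limit is $0$. 4. For $-\tfrac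 t3<x\le t$, $$\tilde\rho(x,t)=\tfrac13\Big(1-\big(-\tfrac12\big)^{\lfloor (t-x+1)/2\rfloor}\Big).$$ (For odd $x+t$ the condition $x>-\tfrac t3$ is equivalent to $x>-\tfrac{t+1}3$.) 5. For every $\zeta\in\mathbb R$ and all integers $x_t$ with $(x_t+\tfrac t2)/\sqrt t\to\zeta$ as $t\to\infty$ (in particular for $x_t=\lfloor -\tfrac t2+\zeta\sqrt t\rfloor$), $$\lim_{t\to\infty}\tilde\rho(x_t,t)=\tfrac1{12}\big(5-\operatorname{erf}(2\zeta)\big),\qquad \operatorname{erf}(z)=\tfrac{2}{\sqrt\pi}\int_0^z e^{-u^2}\,du .$$ -/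

import Mathlib

open MeasureTheory Filter Topology

namespace RuleFiftyFour

/-- Configurations of the infinite chain: a binary variable on every site of `ℤ`. -/
abbrev Config : Type := ℤ → ZMod 2

/-- The local rule with binary code 54. -/
def chi (a b c : ZMod 2) : ZMod 2 := a + b + c + a * c

/-- The half-step that updates all even sites and keeps the odd ones. -/
def stepEven (s : Config) : Config :=
  fun x => if Even x then chi (s (x - 1)) (s x) (s (x + 1)) else s x

/-- The half-step that updates all odd sites and keeps the even ones. -/
def stepOdd (s : Config) : Config :=
  fun x => if Odd x then chi (s (x - 1)) (s x) (s (x + 1)) else s x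

/-- The first `t` time-steps; in the first one the even sites are updated, and the
parity alternates afterwards. -/
def evolve : ℕ → Config → Config
  | 0, s => s
  | t + 1, s => if Even t then stepEven (evolve t s) else stepOdd (evolve t s)

/-- The local density `ρ_x`, as a function of the configuration. -/
noncomputable def density (x : ℤ) (s : Config) : ℝ := if s x = 1 then 1 else 0

/-- The time-evolved density at the origin: `ρ(0) = ρ_0` and `ρ(t+1) = U ρ(t) U`, where
`U` is the (involutive) even half-step for even `t` and the odd half-step for odd `t`.
Conjugating a diagonal operator by `U` amounts to composing its diagonal with `U`. -/
noncomputable def densityOrigin : ℕ → Config → ℝ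
  | 0, s => density 0 s
  | t + 1, s => if Even t then densityOrigin t (stepEven s) else densityOrigin t (stepOdd s)

/-- The product state in which the sites `y ≤ k` are in the maximum-entropy state (independent
and uniform on `{0, 1}`), and the sites `y > k` are empty. -/
noncomputable def halfFilled (k : ℤ) : Measure Config :=
  Measure.infinitePi fun y : ℤ =>
    (if y ≤ k then PMF.uniformOfFintype (ZMod 2) else PMF.pure 0 : PMF (ZMod 2)).toMeasure

/-- The state at time `t` after the quench: the maximum-entropy half-chain `y ≤ 0` is joined at
time `0` to the empty half-chain `y > 0`. -/
noncomputable def quenchState (t : ℕ) : Measure Config := (halfFilled 0).map (evolve t)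

/-- The density profile: the expectation value of `ρ_x` in the state at time `t`. -/
noncomputable def profile (x : ℤ) (t : ℕ) : ℝ := ∫ s, density x s ∂(quenchState t)

/-- `r(m,t)`: the expectation value of the time-evolved density at the origin, in the initial state
shifted by `-x`, where `m = (t-x+1)/2`, so that `-x = 2m-t-1`. -/
noncomputable def r (m : ℤ) (t : ℕ) : ℝ := ∫ s, densityOrigin t s ∂(halfFilled (2 * m - (t : ℤ) - 1))

/-- Binomial coefficient with integer entries, zero unless `0 ≤ k ≤ n`. -/
def binom (n k : ℤ) : ℕ := if 0 ≤ k ∧ k ≤ n then Nat.choose n.toNat k.toNat else 0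

/-- The error function. -/
noncomputable def erf (z : ℝ) : ℝ := 2 / √Real.pi * ∫ u in (0 : ℝ)..z, Real.exp (-u ^ 2)

/-- `evolve` is measurable, so `quenchState` is a genuine image measure. -/
theorem measurable_evolve (t : ℕ) : Measurable (evolve t) := by
  have hg : Measurable (fun p : ZMod 2 × ZMod 2 × ZMod 2 => chi p.1 p.2.1 p.2.2) :=
    Measurable.of_discrete
  have hchi (x : ℤ) : Measurable fun s : Config => chi (s (x - 1)) (s x) (s (x + 1)) := by
    have h : Measurable fun s : Config => (s (x - 1), s x, s (x + 1)) := by fun_prop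
    exact hg.comp h
  have he : Measurable stepEven := by
    refine measurable_pi_lambda _ fun x => ?_
    by_cases h : Even x
    · simpa [stepEven, h] using hchi x
    · simpa [stepEven, h] using measurable_pi_apply x
  have ho : Measurable stepOdd := by
    refine measurable_pi_lambda _ fun x => ?_
    by_cases h : Odd x
    · simpa [stepOdd, h] using hchi x
    · simpa [stepOdd, h] using measurable_pi_apply x
  induction t with
  | zero => exact measurable_id
  | succ t ih =>
    have h : evolve (t + 1) = if Even t then stepEven ∘ evolve t else stepOdd ∘ evolve t := by
      funext s
      by_cases h : Even t <;> simp [evolve, h]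
    rw [h]
    split_ifs
    · exact he.comp ih
    · exact ho.comp ih

instance (k : ℤ) : IsProbabilityMeasure (halfFilled k) := by
  unfold halfFilled; infer_instance

instance (t : ℕ) : IsProbabilityMeasure (quenchState t) :=
  Measure.isProbabilityMeasure_map (measurable_evolve t).aemeasurable

end RuleFiftyFour

namespace RuleFiftyFour

/-! ### Sequences along right-moving light rays -/

/-! The evolution is read along the right-moving light rays `t - x = 2 * m - 1`. Ray `m + 1` is
determined by two fresh initial bits and by ray `m`, through `cross`. Since `chi b · c` permutes the
two bits, uniform bits stay uniform, and only the eventual constant value `c` of a ray carries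
memory. Hence the law of a ray is a mixture of the laws "`τ` uniform bits, then `c` forever".
Passing to the next ray, `c = 0` becomes a fair coin and `τ` grows by one, while `c = 1` (a
right-mover) becomes `0` and `τ` grows by two. So `τ = m + 1 + k`, where `k` counts the earlier rays
with `c = 1`, and solving this two-state chain gives the binomial weights of `rayE_eq_sum`.

At time `t = m + K` ray `m` shows a uniform bit if `k > K`, and `c` otherwise; this is `r_eq_probs`.
For `m ≤ 2 * K + 1` always `k ≤ K`, and iterating `p ↦ (1 - p) / 2` gives the powers of `-1/2`; in
general Pascal's rule gives the exact sums.

On the diffusive scale the probability `B` of `k ≤ K` is a binomial distribution function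
(`belowProb_eq_measure`), so the central limit theorem yields `B → (1 + erf (2 * ζ)) / 2`. The chain
forgets its past geometrically, so `c = 1` has conditional probability tending to `1/3`, and the
limit is `(1 - B) / 2 + B / 3`. -/

/-- Prepend a value to a sequence. -/
def consSeq (b : ZMod 2) (u : ℕ → ZMod 2) : ℕ → ZMod 2
  | 0 => b
  | n + 1 => u n

/-- The values on a light ray, determined from a first value `b` and the values `u` on the
neighbouring ray to the right. -/
def cross (b : ZMod 2) (u : ℕ → ZMod 2) : ℕ → ZMod 2
  | 0 => chi b (u 0) (u 1)
  | n + 1 => chi (cross b u n) (u (n + 1)) (u (n + 2))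

lemma cross_consSeq (b a : ZMod 2) (u : ℕ → ZMod 2) :
    cross b (consSeq a u) = consSeq (chi b a (u 0)) (cross (chi b a (u 0)) u) := by
  funext n
  induction n with
  | zero => rfl
  | succ n ih =>
    rw [cross, ih]
    cases n <;> rfl

lemma cross_const_zero (b : ZMod 2) : cross b (fun _ => 0) = fun _ => b := by
  funext n
  induction n with
  | zero => simp [cross, chi]
  | succ n ih => rw [cross, ih]; simp [chi]

lemma chi_one_one (b : ZMod 2) : chi b 1 1 = 0 := by revert b; decide

lemma cross_const_one (b : ZMod 2) : cross b (fun _ => 1) = fun _ => 0 := by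
  funext n
  cases n <;> exact chi_one_one _

lemma consSeq_const (b : ZMod 2) : consSeq b (fun _ => b) = fun _ => b := by
  funext n; cases n <;> rfl

/-! ### Transfer of "uniform bits, then a constant" from one ray to the next -/

/-- The average over a uniform bit. -/
noncomputable def avg (f : ZMod 2 → ℝ) : ℝ := (f 0 + f 1) / 2

/-- For fixed outer arguments the rule is a bijection of the middle bit, so it preserves the uniform
law. -/
lemma avg_chi (b c : ZMod 2) (f : ZMod 2 → ℝ) : (avg fun a => f (chi b a c)) = avg f := by
  have h : (∀ b c, chi b 0 c = 0 ∧ chi b 1 c = 1 ∨ chi b 0 c = 1 ∧ chi b 1 c = 0) := by decide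
  rcases h b c with ⟨h0, h1⟩ | ⟨h0, h1⟩
  · simp only [avg, h0, h1]
  · simp only [avg, h0, h1, add_comm]

/-- The expectation over a sequence that consists of `τ` independent uniform bits, followed by
the constant `c`. -/
noncomputable def tailE : ℕ → ZMod 2 → ((ℕ → ZMod 2) → ℝ) → ℝ
  | 0, c, f => f fun _ => c
  | τ + 1, c, f => avg fun b => tailE τ c fun u => f (consSeq b u)

lemma tailE_avg (τ : ℕ) (c : ZMod 2) (F : ZMod 2 → (ℕ → ZMod 2) → ℝ) :
    (tailE τ c fun u => avg fun a => F a u) = avg fun a => tailE τ c (F a) := by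
  induction τ generalizing F with
  | zero => rfl
  | succ τ ih =>
    simp only [tailE, ih]
    simp only [avg]; ring

/-- The first uniform bit of `u` erases `b`: the first output `a` is again uniform, independent of
the rest of `u`, and plays the role of `b` from there on. -/
lemma tailE_succ_cross (τ : ℕ) (b c : ZMod 2) (f : (ℕ → ZMod 2) → ℝ) :
    (tailE (τ + 1) c fun u => f (cross b u))
      = avg fun a => tailE τ c fun u => f (consSeq a (cross a u)) := by
  simp only [tailE, cross_consSeq]
  rw [← tailE_avg, ← tailE_avg]
  congr 1
  funext u
  exact avg_chi b (u 0) fun a => f (consSeq a (cross a u))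

/-- Two consecutive ones on the right always give `0`, so a tail of ones leaves a tail of zeros,
whatever bit arrives there. -/
lemma tailE_cross_one (τ : ℕ) (b : ZMod 2) (f : (ℕ → ZMod 2) → ℝ) :
    (tailE τ 1 fun u => f (cross b u)) = tailE τ 0 f := by
  induction τ generalizing b f with
  | zero => simp [tailE, cross_const_one]
  | succ τ ih =>
    rw [tailE_succ_cross, tailE]
    congr 1
    funext a
    exact ih a fun u => f (consSeq a u)

/-- Crossing zeros copies the incoming bit forever. The last of the `τ + 1` uniform outputs thus
becomes the constant tail, a fair coin, leaving `τ` free bits before it. -/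
lemma tailE_cross_zero (τ : ℕ) (b : ZMod 2) (f : (ℕ → ZMod 2) → ℝ) :
    (tailE (τ + 1) 0 fun u => f (cross b u)) = avg fun c => tailE τ c f := by
  induction τ generalizing b f with
  | zero =>
    rw [tailE_succ_cross]
    simp [tailE, cross_const_zero, consSeq_const]
  | succ τ ih =>
    rw [tailE_succ_cross]
    have h (a : ZMod 2) := ih a fun u => f (consSeq a u)
    simp only [h]
    simp only [tailE, avg]; ring

/-- Expectation of `f` on the next ray to the left, given the values on a ray. -/
noncomputable def nextRay (f : (ℕ → ZMod 2) → ℝ) (u : ℕ → ZMod 2) : ℝ :=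
  avg fun b => avg fun a => f (consSeq b (consSeq a (cross a u)))

lemma tailE_nextRay_one (τ : ℕ) (f : (ℕ → ZMod 2) → ℝ) :
    tailE τ 1 (nextRay f) = tailE (τ + 2) 0 f := by
  unfold nextRay
  simp only [tailE_avg]
  have h (b a : ZMod 2) := tailE_cross_one τ a fun u => f (consSeq b (consSeq a u))
  simp only [h]
  rfl

lemma tailE_nextRay_zero (τ : ℕ) (f : (ℕ → ZMod 2) → ℝ) :
    tailE (τ + 1) 0 (nextRay f) = avg fun c => tailE (τ + 2) c f := by
  unfold nextRay
  simp only [tailE_avg]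
  have h (b a : ZMod 2) := tailE_cross_zero τ a fun u => f (consSeq b (consSeq a u))
  simp only [h]
  simp only [tailE, avg]; ring

/-! ### The two-state chain of rays and its binomial weights -/

/-- The expectation over the ray number `m` (counted from the edge of the half-chain). -/
noncomputable def rayE : ℕ → ((ℕ → ZMod 2) → ℝ) → ℝ
  | 0, f => tailE 1 0 f
  | m + 1, f => rayE m (nextRay f)

/-- The probability that ray `m` is eventually empty, and that exactly `k` of the rays to the
right of it are not. -/
noncomputable def emptyWeight (m k : ℕ) : ℝ := (m - k).choose k / 2 ^ (m - k)

/-- The probability that ray `m` eventually carries a right-mover, and that exactly `k` of the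
rays to the right of it do. -/
noncomputable def moverWeight : ℕ → ℕ → ℝ
  | 0, _ => 0
  | m + 1, k => emptyWeight m k / 2

lemma emptyWeight_of_lt {m k : ℕ} (h : m < 2 * k) : emptyWeight m k = 0 := by
  have : (m - k).choose k = 0 := Nat.choose_eq_zero_of_lt (by omega)
  simp [emptyWeight, this]

lemma moverWeight_of_le {m k : ℕ} (h : m ≤ 2 * k) : moverWeight m k = 0 := by
  cases m with
  | zero => rfl
  | succ m => simp [moverWeight, emptyWeight_of_lt (show m < 2 * k by omega)]

lemma emptyWeight_zero_right (m : ℕ) : emptyWeight (m + 1) 0 = emptyWeight m 0 / 2 := by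
  simp [emptyWeight, pow_succ, div_eq_mul_inv, mul_comm]

/-- Pascal's rule, read as the chain: an empty ray follows an empty one with probability `1/2`, or a
right-mover with certainty, which raises the count by one. -/
lemma emptyWeight_succ (m k : ℕ) :
    emptyWeight (m + 1) (k + 1) = emptyWeight m (k + 1) / 2 + moverWeight m k := by
  rcases Nat.lt_or_ge m (k + 1) with h | h
  · rw [emptyWeight_of_lt (by omega), emptyWeight_of_lt (by omega), moverWeight_of_le (by omega)]
    simp
  · obtain ⟨n, rfl⟩ := Nat.exists_eq_add_of_le h
    have e1 : k + 1 + n + 1 - (k + 1) = n + 1 := by omega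
    have e2 : k + 1 + n - (k + 1) = n := by omega
    have e3 : k + 1 + n = (k + n) + 1 := by omega
    have e4 : k + n - k = n := by omega
    rw [emptyWeight, emptyWeight, e1, e2, e3, moverWeight, emptyWeight, e4,
      Nat.choose_succ_succ]
    push_cast
    field_simp
    ring

/-- The cutoff `N` is free because the weights vanish for `2 * k > m`; the induction uses this to
lower it by one and to shift the sum by one. -/
theorem rayE_eq_sum (m N : ℕ) (hN : m < N) (f : (ℕ → ZMod 2) → ℝ) :
    rayE m f = ∑ k ∈ Finset.range N,
      (emptyWeight m k * tailE (m + 1 + k) 0 f + moverWeight m k * tailE (m + 1 + k) 1 f) := by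
  induction m generalizing N f with
  | zero =>
    rw [Finset.sum_eq_single 0]
    · simp [rayE, emptyWeight, moverWeight]
    · intro k _ hk
      rw [emptyWeight_of_lt (by omega)]; simp [moverWeight]
    · intro h
      exact absurd (Finset.mem_range.2 hN) h
  | succ m ih =>
    obtain ⟨N, rfl⟩ : ∃ n, N = n + 1 := ⟨N - 1, by omega⟩
    rw [rayE, ih N (by omega)]
    have h0 (k : ℕ) : tailE (m + 1 + k) 0 (nextRay f)
        = avg fun c => tailE (m + 1 + 1 + k) c f := by
      have := tailE_nextRay_zero (m + k) f
      rwa [show m + k + 1 = m + 1 + k by omega, show m + k + 2 = m + 1 + 1 + k by omega] at this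
    have h1 (k : ℕ) : tailE (m + 1 + k) 1 (nextRay f) = tailE (m + 1 + 1 + (k + 1)) 0 f := by
      rw [tailE_nextRay_one]; congr 1; omega
    have hw (k : ℕ) : moverWeight (m + 1) k = emptyWeight m k / 2 := rfl
    simp only [h0, h1, hw, Finset.sum_add_distrib, avg]
    rw [Finset.sum_range_succ' _ N, Finset.sum_range_succ _ N,
      emptyWeight_of_lt (show m < 2 * N by omega), emptyWeight_zero_right]
    simp only [emptyWeight_succ, add_mul, Finset.sum_add_distrib]
    have hs := Finset.sum_range_succ'
      (fun k => emptyWeight m k / 2 * tailE (m + 1 + 1 + k) 0 f) N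
    rw [Finset.sum_range_succ, emptyWeight_of_lt (show m < 2 * N by omega)] at hs
    have hd : ∑ k ∈ Finset.range N, emptyWeight m k *
        ((tailE (m + 1 + 1 + k) 0 f + tailE (m + 1 + 1 + k) 1 f) / 2)
        = ∑ k ∈ Finset.range N, emptyWeight m k / 2 * tailE (m + 1 + 1 + k) 0 f
          + ∑ k ∈ Finset.range N, emptyWeight m k / 2 * tailE (m + 1 + 1 + k) 1 f := by
      rw [← Finset.sum_add_distrib]
      exact Finset.sum_congr rfl fun k _ => by ring
    rw [hd]
    linarith

/-- The indicator of an occupied site. -/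
noncomputable def occ (a : ZMod 2) : ℝ := if a = 1 then 1 else 0

lemma tailE_const (τ : ℕ) (c : ZMod 2) (x : ℝ) : (tailE τ c fun _ => x) = x := by
  induction τ with
  | zero => rfl
  | succ τ ih => simp [tailE, ih, avg]

lemma tailE_occ (τ j : ℕ) (c : ZMod 2) :
    (tailE τ c fun u => occ (u j)) = if j < τ then 1 / 2 else occ c := by
  induction τ generalizing j with
  | zero => simp [tailE]
  | succ τ ih =>
    cases j with
    | zero => simp [tailE, consSeq, tailE_const, avg, occ]
    | succ j => simp [tailE, consSeq, ih, avg]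

lemma rayE_const (m : ℕ) (x : ℝ) : (rayE m fun _ => x) = x := by
  induction m with
  | zero => exact tailE_const 1 0 x
  | succ m ih =>
    rw [rayE]
    convert ih using 2
    funext u
    simp [nextRay, avg]

lemma sum_weights (m N : ℕ) (hN : m < N) :
    ∑ k ∈ Finset.range N, (emptyWeight m k + moverWeight m k) = 1 := by
  have := rayE_eq_sum m N hN fun _ => 1
  simpa [tailE_const, rayE_const] using this.symm

/-! ### Resampling one coordinate of a product measure -/

lemma measurePreserving_update {ι : Type*} [DecidableEq ι] {X : ι → Type*}
    [∀ i, MeasurableSpace (X i)] (μ : ∀ i, Measure (X i)) [∀ i, IsProbabilityMeasure (μ i)]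
    (i : ι) :
    MeasurePreserving (fun p : X i × (∀ i, X i) => Function.update p.2 i p.1)
      ((μ i).prod (Measure.infinitePi μ)) (Measure.infinitePi μ) := by
  have hm : Measurable fun p : X i × (∀ i, X i) => Function.update p.2 i p.1 := by
    refine measurable_pi_lambda _ fun j => ?_
    by_cases h : j = i
    · subst h; simpa using measurable_fst
    · simp only [Function.update_of_ne h]; fun_prop
  refine ⟨hm, Measure.eq_infinitePi _ fun s t ht => ?_⟩
  rw [Measure.map_apply hm (.pi s.countable_toSet fun j _ => ht j)]
  have hpre : (fun p : X i × (∀ i, X i) => Function.update p.2 i p.1) ⁻¹' (s : Set ι).pi t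
      = (if i ∈ s then t i else Set.univ) ×ˢ ((s.erase i : Finset ι) : Set ι).pi t := by
    ext ⟨b, u⟩
    simp only [Set.mem_preimage, Set.mem_pi, Set.mem_prod, Finset.mem_coe, Finset.mem_erase]
    constructor
    · intro h
      refine ⟨?_, fun j hj => by simpa [hj.1] using h j hj.2⟩
      split_ifs with hi
      · simpa using h i hi
      · trivial
    · rintro ⟨h1, h2⟩ j hj
      by_cases hji : j = i
      · subst hji; simpa [hj] using h1
      · simpa [hji] using h2 j ⟨hji, hj⟩
  rw [hpre, Measure.prod_prod, Measure.infinitePi_pi _ fun j _ => ht j]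
  split_ifs with hi
  · exact Finset.mul_prod_erase s (fun j => μ j (t j)) hi
  · simp [Finset.erase_eq_of_notMem hi]

/-- Redrawing one uniform site does not change the state. This lets the infinite product be
integrated out one site at a time. -/
lemma integral_halfFilled_update {k y : ℤ} (hy : y ≤ k) {f : Config → ℝ} (hf : Measurable f)
    {C : ℝ} (hC : ∀ s, |f s| ≤ C) :
    ∫ s, f s ∂(halfFilled k)
      = avg fun b => ∫ s, f (Function.update s y b) ∂(halfFilled k) := by
  have hp := measurePreserving_update (fun y : ℤ =>
    (if y ≤ k then PMF.uniformOfFintype (ZMod 2) else PMF.pure 0 : PMF (ZMod 2)).toMeasure) y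
  have hint : Integrable (fun p : ZMod 2 × Config => f (Function.update p.2 y p.1))
      ((if y ≤ k then PMF.uniformOfFintype (ZMod 2) else PMF.pure 0 : PMF (ZMod 2)).toMeasure.prod
        (halfFilled k)) :=
    Integrable.of_bound (hf.comp hp.measurable).aestronglyMeasurable C
      (ae_of_all _ fun p => hC _)
  have h1 : ∫ s, f s ∂(halfFilled k) = ∫ p : ZMod 2 × Config, f (Function.update p.2 y p.1)
      ∂((if y ≤ k then PMF.uniformOfFintype (ZMod 2) else PMF.pure 0 : PMF (ZMod 2)).toMeasure.prod
        (halfFilled k)) := by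
    conv_lhs => rw [halfFilled, ← hp.map_eq]
    exact integral_map hp.measurable.aemeasurable hf.aestronglyMeasurable
  rw [h1, integral_prod _ hint, if_pos hy, PMF.integral_eq_sum]
  rw [show (Finset.univ : Finset (ZMod 2)) = {0, 1} from rfl, Finset.sum_pair (by decide)]
  simp [avg, PMF.uniformOfFintype_apply, ZMod.card]
  ring

lemma ae_halfFilled_vacuum (k : ℤ) : ∀ᵐ s ∂(halfFilled k), ∀ y, k < y → s y = 0 := by
  rw [ae_all_iff]
  intro y
  by_cases hy : k < y
  · have hp := measurePreserving_eval_infinitePi (fun y : ℤ =>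
      (if y ≤ k then PMF.uniformOfFintype (ZMod 2) else PMF.pure 0 : PMF (ZMod 2)).toMeasure) y
    have h0 : ∀ᵐ a ∂((if y ≤ k then PMF.uniformOfFintype (ZMod 2) else PMF.pure 0 :
        PMF (ZMod 2)).toMeasure), a = 0 := by
      rw [if_neg (not_le.2 hy), PMF.toMeasure_pure]
      rw [ae_dirac_eq]; simp
    filter_upwards [hp.quasiMeasurePreserving.ae h0] with s hs _
    exact hs
  · exact ae_of_all _ fun s h => absurd h hy

lemma map_shift_halfFilled (k x : ℤ) :
    (halfFilled k).map (fun (s : Config) y => s (y + x)) = halfFilled (k - x) := by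
  have hm : Measurable fun (s : Config) (y : ℤ) => s (y + x) := by fun_prop
  refine Measure.eq_infinitePi _ fun s t ht => ?_
  rw [Measure.map_apply hm (.pi s.countable_toSet fun j _ => ht j)]
  have hpre : (fun (s : Config) (y : ℤ) => s (y + x)) ⁻¹' (s : Set ℤ).pi t
      = ((s.map (Equiv.addRight x).toEmbedding : Finset ℤ) : Set ℤ).pi fun y => t (y - x) := by
    ext u
    constructor
    · intro h y hy
      have := h (y - x) (by simpa [sub_eq_add_neg] using hy)
      simpa using this
    · intro h y hy
      have := h (y + x) (by simpa using hy)
      simpa using this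
  rw [hpre, halfFilled, Measure.infinitePi_pi _ fun j _ => ht _, Finset.prod_map]
  refine Finset.prod_congr rfl fun y _ => ?_
  change (if y + x ≤ k then PMF.uniformOfFintype (ZMod 2) else PMF.pure 0 :
    PMF (ZMod 2)).toMeasure (t (y + x - x)) = _
  rw [add_sub_cancel_right]
  by_cases h : y + x ≤ k
  · rw [if_pos h, if_pos (le_sub_iff_add_le.2 h)]
  · rw [if_neg h, if_neg (mt le_sub_iff_add_le.1 h)]

/-! ### Rays in space-time -/

/-- The ray `m` of a configuration whose positive sites are empty. -/
def ray : ℕ → Config → ℕ → ZMod 2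
  | 0, s => consSeq (s 0) fun _ => 0
  | m + 1, s => consSeq (s (-2 * (m : ℤ) - 2)) (consSeq (s (-2 * (m : ℤ) - 1))
      (cross (s (-2 * (m : ℤ) - 1)) (ray m s)))

/-- Expresses that the two sites entering ray `m + 1` are fresh, hence can be redrawn without
affecting ray `m`. -/
lemma ray_congr (m : ℕ) {s s' : Config} (h : ∀ y, -2 * (m : ℤ) ≤ y → s y = s' y) :
    ray m s = ray m s' := by
  induction m with
  | zero => simp [ray, h 0 (by simp)]
  | succ m ih =>
    rw [ray, ray, ih fun y hy => h y (by push_cast; omega), h _ (by push_cast; omega),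
      h _ (by push_cast; omega)]

lemma measurable_chi {α : Type*} [MeasurableSpace α] {f g h : α → ZMod 2} (hf : Measurable f)
    (hg : Measurable g) (hh : Measurable h) : Measurable fun a => chi (f a) (g a) (h a) := by
  unfold chi
  fun_prop

lemma measurable_consSeq {α : Type*} [MeasurableSpace α] {f : α → ZMod 2} {g : α → ℕ → ZMod 2}
    (hf : Measurable f) (hg : Measurable g) : Measurable fun a => consSeq (f a) (g a) := by
  refine measurable_pi_lambda _ fun n => ?_
  cases n with
  | zero => exact hf
  | succ n => exact (measurable_pi_apply n).comp hg

lemma measurable_cross {α : Type*} [MeasurableSpace α] {f : α → ZMod 2} {g : α → ℕ → ZMod 2}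
    (hf : Measurable f) (hg : Measurable g) : Measurable fun a => cross (f a) (g a) := by
  refine measurable_pi_lambda _ fun n => ?_
  have hgn (n : ℕ) : Measurable fun a => g a n := (measurable_pi_apply n).comp hg
  induction n with
  | zero => exact measurable_chi hf (hgn 0) (hgn 1)
  | succ n ih => exact measurable_chi ih (hgn _) (hgn _)

lemma measurable_ray (m : ℕ) : Measurable (ray m) := by
  induction m with
  | zero => exact measurable_consSeq (measurable_pi_apply _) measurable_const
  | succ m ih =>
    exact measurable_consSeq (measurable_pi_apply _)
      (measurable_consSeq (measurable_pi_apply _) (measurable_cross (measurable_pi_apply _) ih))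

lemma abs_avg_le {f : ZMod 2 → ℝ} {C : ℝ} (h : ∀ b, |f b| ≤ C) : |avg f| ≤ C := by
  have h0 := abs_le.1 (h 0)
  have h1 := abs_le.1 (h 1)
  rw [avg, abs_le]
  constructor <;> linarith [h0.1, h0.2, h1.1, h1.2]

lemma measurable_nextRay {f : (ℕ → ZMod 2) → ℝ} (hf : Measurable f) : Measurable (nextRay f) := by
  have h (b a : ZMod 2) : Measurable fun u => f (consSeq b (consSeq a (cross a u))) :=
    hf.comp (measurable_consSeq measurable_const
      (measurable_consSeq measurable_const (measurable_cross measurable_const measurable_id)))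
  exact ((((h 0 0).add (h 0 1)).div_const 2).add (((h 1 0).add (h 1 1)).div_const 2)).div_const 2

theorem integral_ray (m : ℕ) {f : (ℕ → ZMod 2) → ℝ} (hf : Measurable f) {C : ℝ}
    (hC : ∀ u, |f u| ≤ C) : ∫ s, f (ray m s) ∂(halfFilled 0) = rayE m f := by
  induction m generalizing f with
  | zero =>
    have hr : Measurable fun s => f (ray 0 s) := hf.comp (measurable_ray 0)
    rw [integral_halfFilled_update (le_refl (0 : ℤ)) hr fun s => hC _]
    simp [ray, rayE, tailE]
  | succ m ih =>
    have hr : Measurable fun s => f (ray (m + 1) s) := hf.comp (measurable_ray _)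
    rw [rayE, ← ih (measurable_nextRay hf) fun u => abs_avg_le fun b => abs_avg_le fun a => hC _]
    rw [integral_halfFilled_update (y := -2 * (m : ℤ) - 2) (by omega) hr fun s => hC _]
    have hupd (b : ZMod 2) : Measurable fun s : Config =>
        Function.update s (-2 * (m : ℤ) - 2) b := by fun_prop
    have h2 (b : ZMod 2) := integral_halfFilled_update (k := 0) (y := -2 * (m : ℤ) - 1) (by omega)
      (hr.comp (hupd b)) fun s => hC _
    simp only [Function.comp_def] at h2
    simp only [h2]
    have h3 (b a : ZMod 2) (s : Config) :
        ray (m + 1) (Function.update (Function.update s (-2 * (m : ℤ) - 1) a)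
          (-2 * (m : ℤ) - 2) b) = consSeq b (consSeq a (cross a (ray m s))) := by
      have hc : ray m (Function.update (Function.update s (-2 * (m : ℤ) - 1) a)
          (-2 * (m : ℤ) - 2) b) = ray m s := ray_congr m fun y hy => by
        rw [Function.update_of_ne (by omega), Function.update_of_ne (by omega)]
      rw [ray, hc, Function.update_self, Function.update_of_ne (by omega), Function.update_self]
    simp only [h3]
    have hi (b a : ZMod 2) : Integrable
        (fun s => f (consSeq b (consSeq a (cross a (ray m s))))) (halfFilled 0) :=
      Integrable.of_bound (hf.comp (measurable_consSeq measurable_const (measurable_consSeq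
        measurable_const (measurable_cross measurable_const
          (measurable_ray m))))).aestronglyMeasurable C (ae_of_all _ fun s => hC _)
    simp only [nextRay, avg]
    have hj (b : ZMod 2) : Integrable (fun s => (f (consSeq b (consSeq 0 (cross 0 (ray m s))))
        + f (consSeq b (consSeq 1 (cross 1 (ray m s))))) / 2) (halfFilled 0) :=
      ((hi b 0).add (hi b 1)).div_const 2
    rw [integral_div, integral_add (hj 0) (hj 1), integral_div, integral_div,
      integral_add (hi _ _) (hi _ _), integral_add (hi _ _) (hi _ _)]

/-! ### Identification of the space-time configuration with the rays -/

/-- Sites are updated only every other time-step. -/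
lemma evolve_succ_of_even {t : ℕ} {x : ℤ} (h : Even (x + (t + 1 : ℕ))) (s : Config) :
    evolve (t + 1) s x = evolve t s x := by
  by_cases ht : Even t
  · have hx : ¬ Even x := by grind
    simp [evolve, ht, stepEven, hx]
  · have hx : ¬ Odd x := by grind
    simp [evolve, ht, stepOdd, hx]

lemma evolve_succ_of_odd {t : ℕ} {x : ℤ} (h : Odd (x + (t + 1 : ℕ))) (s : Config) :
    evolve (t + 1) s x = chi (evolve t s (x - 1)) (evolve t s x) (evolve t s (x + 1)) := by
  by_cases ht : Even t
  · have hx : Even x := by grind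
    simp [evolve, ht, stepEven, hx]
  · have hx : Odd x := by grind
    simp [evolve, ht, stepOdd, hx]

lemma evolve_vacuum {s : Config} (hs : ∀ y, 0 < y → s y = 0) (t : ℕ) (x : ℤ) (h : (t : ℤ) < x) :
    evolve t s x = 0 := by
  induction t generalizing x with
  | zero => exact hs x (by simpa using h)
  | succ t ih =>
    push_cast at h
    rcases Int.even_or_odd (x + (t + 1 : ℕ)) with he | ho
    · rw [evolve_succ_of_even he, ih x (by omega)]
    · rw [evolve_succ_of_odd ho, ih x (by omega), ih _ (by omega), ih _ (by omega)]
      rfl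

/-- The values of the space-time configuration on the ray `t - x = 2 m - 1`, starting with the
initial value at an even site. -/
def field (s : Config) (m : ℤ) : ℕ → ZMod 2
  | 0 => s (-2 * m)
  | t + 1 => evolve t s (t + 1 - 2 * m)

/-- The left neighbour lies on the same ray and the right one on ray `m`. The site itself was not
touched in the previous step, so its value is also found on ray `m`, one place earlier. -/
lemma field_succ (s : Config) (m : ℤ) (j : ℕ) :
    field s (m + 1) (j + 2)
      = chi (field s (m + 1) (j + 1)) (field s m j) (field s m (j + 1)) := by
  have h1 := evolve_succ_of_odd (t := j) (x := ((j + 1 : ℕ) : ℤ) + 1 - 2 * (m + 1))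
    ⟨j - m, by push_cast; ring⟩ s
  rw [field, h1, field, field]
  congr 1
  · congr 1; push_cast; ring
  · cases j with
    | zero => simp [field, evolve]; ring_nf
    | succ i =>
      rw [evolve_succ_of_even ⟨i + 1 - m, by push_cast; ring⟩, field]
      congr 1; push_cast; ring
  · congr 1; push_cast; ring

lemma field_eq_ray {s : Config} (hs : ∀ y, 0 < y → s y = 0) (m : ℕ) :
    field s m = ray m s := by
  induction m with
  | zero =>
    -- Ray `-1` runs outside the light-cone of the filled half, so ray `0` can start the recursion
    -- from vacuum.
    have hneg (j : ℕ) : field s (-1) j = 0 := by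
      cases j with
      | zero => exact hs _ (by norm_num)
      | succ t => exact evolve_vacuum hs _ _ (by omega)
    funext j
    rcases j with _ | j
    · simp [field, ray, consSeq]
    · change field s 0 (j + 1) = 0
      induction j with
      | zero => exact hs _ (by norm_num)
      | succ j ih =>
        have := field_succ s (-1) j
        rw [hneg, hneg] at this
        simpa [ih, chi] using this
  | succ m ih =>
    have h1 : field s ((m + 1 : ℕ) : ℤ) 1 = s (-2 * (m : ℤ) - 1) := by
      simp only [field, evolve]; congr 1; push_cast; ring
    funext j
    rcases j with _ | j
    · simp only [field, ray, consSeq]; congr 1; push_cast; ring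
    · rcases j with _ | j
      · exact h1
      · rw [ray]
        change _ = cross _ _ j
        induction j with
        | zero => rw [← ih, cross, ← h1]; exact field_succ s m 0
        | succ j ihj => rw [cross, ← ihj, ← ih]; exact field_succ s m (j + 1)

/-- The density profile is an expectation value on a single ray. -/
lemma profile_eq_integral (x : ℤ) (t : ℕ) :
    profile x t = ∫ s, occ (evolve t s x) ∂(halfFilled 0) := by
  have hd : Measurable (density x) :=
    (Measurable.of_discrete (f := fun a : ZMod 2 => if a = 1 then (1 : ℝ) else 0)).comp
      (measurable_pi_apply x)
  rw [profile, quenchState, integral_map (measurable_evolve t).aemeasurable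
    hd.aestronglyMeasurable]
  rfl

lemma abs_occ_le (a : ZMod 2) : |occ a| ≤ 1 := by
  unfold occ; split_ifs <;> simp

lemma integral_field (m j : ℕ) :
    ∫ s, occ (field s m j) ∂(halfFilled 0) = rayE m fun u => occ (u j) := by
  rw [← integral_ray m (f := fun u => occ (u j))
    ((Measurable.of_discrete (f := occ)).comp (measurable_pi_apply j)) fun u => abs_occ_le _]
  refine integral_congr_ae ?_
  filter_upwards [ae_halfFilled_vacuum 0] with s hs
  rw [field_eq_ray hs]

theorem profile_odd (m t : ℕ) :
    profile (t + 1 - 2 * (m : ℤ)) t = rayE m fun u => occ (u (t + 1)) := by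
  rw [profile_eq_integral, ← integral_field]
  rfl

theorem profile_even (m t : ℕ) :
    profile (t - 2 * (m : ℤ)) t = rayE m fun u => occ (u t) := by
  rw [profile_eq_integral, ← integral_field]
  refine integral_congr_ae (ae_of_all _ fun s => ?_)
  cases t with
  | zero => simp [field, evolve]
  | succ t =>
    simp only
    rw [evolve_succ_of_even ⟨t + 1 - m, by push_cast; ring⟩]
    simp [field]

theorem profile_right_of_lightcone {x : ℤ} {t : ℕ} (h : (t : ℤ) < x) : profile x t = 0 := by
  rw [profile_eq_integral]
  refine integral_eq_zero_of_ae ?_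
  filter_upwards [ae_halfFilled_vacuum 0] with s hs
  simp [evolve_vacuum hs t x h, occ]

/-! ### The observable in the Heisenberg picture -/

/-- `t` alternating half-steps, the first of which updates the sites with the parity of `p`. -/
def evolveFrom : ℤ → ℕ → Config → Config
  | _, 0, s => s
  | p, t + 1, s => evolveFrom (p + 1) t (if Even p then stepEven s else stepOdd s)

lemma evolveFrom_succ (p : ℤ) (t : ℕ) (s : Config) :
    evolveFrom p (t + 1) s = if Even (p + t) then stepEven (evolveFrom p t s)
      else stepOdd (evolveFrom p t s) := by
  induction t generalizing p s with
  | zero => simp [evolveFrom]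
  | succ t ih =>
    rw [evolveFrom, ih, evolveFrom]
    rw [show p + 1 + (t : ℤ) = p + (t + 1 : ℕ) by push_cast; ring]

lemma evolveFrom_congr {p q : ℤ} (h : Even (p - q)) (t : ℕ) (s : Config) :
    evolveFrom p t s = evolveFrom q t s := by
  induction t generalizing p q s with
  | zero => rfl
  | succ t ih =>
    have hpq : Even p ↔ Even q := by grind
    rw [evolveFrom, evolveFrom, ih (q := q + 1) (by simpa using h)]
    simp [hpq]

lemma evolve_eq_evolveFrom (t : ℕ) (s : Config) : evolve t s = evolveFrom 0 t s := by
  induction t with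
  | zero => rfl
  | succ t ih => rw [evolveFrom_succ, ← ih]; simp [evolve]

/-- In the Heisenberg picture the half-step added last acts first on `s`; its parity is that of `t -
1`, hence of `t + 1`. -/
lemma densityOrigin_eq (t : ℕ) (s : Config) :
    densityOrigin t s = density 0 (evolveFrom (t + 1) t s) := by
  induction t generalizing s with
  | zero => rfl
  | succ t ih =>
    rw [evolveFrom, evolveFrom_congr (q := t + 1) ⟨1, by push_cast; ring⟩, densityOrigin]
    have h : Even (((t + 1 : ℕ) : ℤ) + 1) ↔ Even t := by grind
    simp only [h, ih]
    split_ifs <;> rfl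

lemma evolveFrom_shift (p x : ℤ) (t : ℕ) (s : Config) :
    evolveFrom p t (fun y => s (y + x)) = fun y => evolveFrom (p + x) t s (y + x) := by
  induction t generalizing p s with
  | zero => rfl
  | succ t ih =>
    have hstep : (if Even p then stepEven fun y => s (y + x) else stepOdd fun y => s (y + x))
        = fun y => (if Even (p + x) then stepEven s else stepOdd s) (y + x) := by
      funext y
      have e1 : y + x - 1 = y - 1 + x := by ring
      have e2 : y + x + 1 = y + 1 + x := by ring
      by_cases hp : Even p <;> by_cases hx : Even x <;> by_cases hy : Even y <;>
        simp [stepEven, stepOdd, Int.even_add, ← Int.not_even_iff_odd, hp, hx, hy, e1, e2]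
    rw [evolveFrom, hstep, ih, evolveFrom, show p + 1 + x = p + x + 1 by ring]

/-- Translation by `x` moves the observed site to the origin. As `t + 1 + x` is even, the two orders
of half-steps then agree. -/
theorem profile_eq_r {x m : ℤ} {t : ℕ} (h : x + t + 1 = 2 * (t + 1 - m)) :
    profile x t = r m t := by
  have hk : 2 * m - (t : ℤ) - 1 = 0 - x := by linarith
  have hm : Measurable fun (s : Config) (y : ℤ) => s (y + x) := by fun_prop
  have hev (s : Config) : densityOrigin t (fun y => s (y + x)) = occ (evolve t s x) := by
    rw [densityOrigin_eq, evolveFrom_shift, evolve_eq_evolveFrom,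
      evolveFrom_congr (q := 0) ⟨t + 1 - m, by linarith⟩]
    simp [density, occ]
  have hmd : Measurable (densityOrigin t) := by
    have : densityOrigin t = (fun s => occ (evolve t s x)) ∘ fun (s : Config) y => s (y + -x) := by
      funext s
      simp only [Function.comp_apply]
      rw [← hev]
      simp
    rw [this]
    exact ((Measurable.of_discrete (f := occ)).comp ((measurable_pi_apply x).comp
      (measurable_evolve t))).comp (by fun_prop)
  rw [profile_eq_integral, r, hk, ← map_shift_halfFilled, integral_map hm.aemeasurable
    hmd.aestronglyMeasurable]
  simp only [hev]

/-! ### Closed forms -/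

/-- The probability that at most `K` of the rays to the right of ray `m` carry right-movers. -/
noncomputable def belowProb (m K : ℕ) : ℝ :=
  ∑ k ∈ Finset.range (K + 1), (emptyWeight m k + moverWeight m k)

/-- The probability that ray `m` carries a right-mover, and at most `K` of the rays to the right
of it do. -/
noncomputable def moverProb (m K : ℕ) : ℝ := ∑ k ∈ Finset.range (K + 1), moverWeight m k

lemma r_eq_rayE (m t : ℕ) : r m t = rayE m fun u => occ (u (t + 1)) := by
  rw [← profile_eq_r (x := t + 1 - 2 * m) (by ring), profile_odd]

/-- The observed entry has index `m + K + 1` and the uniform part has length `m + 1 + k`, so the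
entry is uniform exactly when `k > K`. -/
theorem r_eq_probs (m K : ℕ) :
    r m (m + K) = (1 - belowProb m K) / 2 + moverProb m K := by
  have hs (g : ℕ → ℝ) : ∑ k ∈ Finset.range (m + K + 1), (if k < K + 1 then g k else 0)
      = ∑ k ∈ Finset.range (K + 1), g k := by
    rw [← Finset.sum_filter]
    congr 1
    ext k
    simp only [Finset.mem_filter, Finset.mem_range]
    omega
  have hw := sum_weights m (m + K + 1) (by omega)
  rw [r_eq_rayE, rayE_eq_sum m (m + K + 1) (by omega), belowProb, moverProb, ← hs, ← hs, ← hw,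
    ← Finset.sum_sub_distrib, Finset.sum_div, ← Finset.sum_add_distrib]
  refine Finset.sum_congr rfl fun k _ => ?_
  rw [tailE_occ, tailE_occ]
  by_cases h : k < K + 1
  · rw [if_neg (by omega), if_neg (by omega), if_pos h, if_pos h]
    simp [occ]
  · rw [if_pos (by omega), if_pos (by omega), if_neg h, if_neg h]
    ring

lemma belowProb_zero (K : ℕ) : belowProb 0 K = 1 := sum_weights 0 (K + 1) (by omega)

lemma moverProb_zero (K : ℕ) : moverProb 0 K = 0 := by simp [moverProb, moverWeight]

lemma moverProb_succ (m K : ℕ) : moverProb (m + 1) K = (belowProb m K - moverProb m K) / 2 := by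
  rw [moverProb, moverProb, belowProb, ← Finset.sum_sub_distrib, Finset.sum_div]
  exact Finset.sum_congr rfl fun k _ => by rw [moverWeight]; ring

/-- The count never decreases, and it leaves `k ≤ K` only when ray `m` is a right-mover with exactly
`K` before it. -/
lemma belowProb_succ (m K : ℕ) : belowProb (m + 1) K = belowProb m K - moverWeight m K := by
  have hm (k : ℕ) : moverWeight (m + 1) k = emptyWeight m k / 2 := rfl
  have hsplit := Finset.sum_range_succ' (fun k => emptyWeight m k / 2) K
  simp only [belowProb, Finset.sum_add_distrib, hm, ← Finset.sum_div] at hsplit ⊢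
  rw [Finset.sum_range_succ' _ K, Finset.sum_range_succ (moverWeight m) K, emptyWeight_zero_right]
  simp only [emptyWeight_succ, Finset.sum_add_distrib, ← Finset.sum_div]
  linarith

lemma one_sub_belowProb (M K : ℕ) :
    1 - belowProb (M + 1) K = (∑ j ∈ Finset.range M, emptyWeight j K) / 2 := by
  induction M with
  | zero => simp [belowProb_succ, belowProb_zero, moverWeight]
  | succ M ih =>
    rw [belowProb_succ, Finset.sum_range_succ, add_div, ← ih, moverWeight]
    ring

lemma moverProb_succ_eq (M K : ℕ) :
    moverProb (M + 1) K = (∑ y ∈ Finset.range (K + 1), emptyWeight M y) / 2 := by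
  rw [moverProb, Finset.sum_div]; rfl

lemma belowProb_of_le {m K : ℕ} (h : m ≤ 2 * K + 1) : belowProb m K = 1 := by
  rw [← sum_weights m (m + K + 1) (by omega), belowProb]
  refine Finset.sum_subset (fun k hk => ?_) fun k _ hk => ?_
  · simp only [Finset.mem_range] at hk ⊢; omega
  · simp only [Finset.mem_range, not_lt] at hk
    rw [emptyWeight_of_lt (by omega), moverWeight_of_le (by omega), add_zero]

/-- The recursion reads `belowProb` one ray earlier, so the range is one larger than in
`belowProb_of_le`. -/
lemma moverProb_of_le {m K : ℕ} (h : m ≤ 2 * K + 2) :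
    moverProb m K = 1 / 3 * (1 - (-1 / 2) ^ m) := by
  induction m with
  | zero => simp [moverProb_zero]
  | succ m ih =>
    rw [moverProb_succ, belowProb_of_le (by omega), ih (by omega), pow_succ]
    ring

theorem r_of_right_movers {m K : ℕ} (h : m ≤ 2 * K + 1) :
    r m (m + K) = 1 / 3 * (1 - (-1 / 2) ^ m) := by
  rw [r_eq_probs, belowProb_of_le h, moverProb_of_le (by omega)]
  ring

/-! ### The exact form of `r` -/

lemma binom_of_neg {n k : ℤ} (h : n < 0) : binom n k = 0 := if_neg (by omega)

lemma binom_of_neg_right {n k : ℤ} (h : k < 0) : binom n k = 0 := if_neg (by omega)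

lemma binom_of_lt {n k : ℤ} (h : n < k) : binom n k = 0 := if_neg (by omega)

lemma binom_natCast (n k : ℕ) : binom n k = n.choose k := by
  rcases Nat.lt_or_ge n k with h | h
  · rw [binom_of_lt (by exact_mod_cast h), Nat.choose_eq_zero_of_lt h]
  · rw [binom, if_pos ⟨by omega, by omega⟩]; rfl

lemma binom_succ (n : ℕ) (k : ℤ) : binom (n + 1) k = binom n k + binom n (k - 1) := by
  rcases lt_or_ge k 0 with h | h
  · rw [binom_of_neg_right h, binom_of_neg_right h, binom_of_neg_right (by omega)]
  · lift k to ℕ using h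
    cases k with
    | zero =>
      rw [binom_of_neg_right (n := n) (k := ((0 : ℕ) : ℤ) - 1) (by norm_num)]
      have := binom_natCast (n + 1) 0
      push_cast at this ⊢
      have h2 := binom_natCast n 0
      push_cast at h2
      rw [this, h2]; simp
    | succ k =>
      have h1 := binom_natCast (n + 1) (k + 1)
      have h2 := binom_natCast n (k + 1)
      have h3 := binom_natCast n k
      push_cast at h1 h2 ⊢
      rw [add_sub_cancel_right, h1, h2, h3, Nat.choose_succ_succ, add_comm]

lemma sum_binom_succ (n : ℕ) (a : ℤ) :
    ∑ y ∈ Finset.Icc a (n + 1), binom (n + 1) y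
      = 2 * ∑ y ∈ Finset.Icc a n, binom n y + binom n (a - 1) := by
  have h1 : ∑ y ∈ Finset.Icc a ((n : ℤ) + 1), binom n y = ∑ y ∈ Finset.Icc a (n : ℤ), binom n y := by
    symm
    refine Finset.sum_subset (Finset.Icc_subset_Icc le_rfl (by omega)) fun y hy hy' => ?_
    simp only [Finset.mem_Icc] at hy hy'
    exact binom_of_lt (by omega)
  have h2 : ∑ y ∈ Finset.Icc a ((n : ℤ) + 1), binom n (y - 1)
      = ∑ y ∈ Finset.Icc (a - 1) (n : ℤ), binom n y := by
    refine Finset.sum_bij' (fun y _ => y - 1) (fun y _ => y + 1) ?_ ?_ ?_ ?_ ?_ <;>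
      simp
  have h3 : ∑ y ∈ Finset.Icc (a - 1) (n : ℤ), binom n y
      = ∑ y ∈ Finset.Icc a (n : ℤ), binom n y + binom n (a - 1) := by
    rcases le_or_gt (a - 1) n with h | h
    · have hI : Finset.Icc (a - 1) (n : ℤ) = insert (a - 1) (Finset.Icc a n) := by
        ext y; simp only [Finset.mem_Icc, Finset.mem_insert]; omega
      rw [hI, Finset.sum_insert (by simp), add_comm]
    · rw [Finset.Icc_eq_empty (by omega), Finset.Icc_eq_empty (by omega), binom_of_lt h]
      simp
  simp only [binom_succ, Finset.sum_add_distrib, h1, h2, h3]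
  ring

lemma emptyWeight_add (K i : ℕ) : emptyWeight (K + i) K = binom i K / 2 ^ i := by
  rw [emptyWeight, Nat.add_sub_cancel_left, binom_natCast]

lemma sum_emptyWeight_self (K : ℕ) : ∑ j ∈ Finset.range K, emptyWeight j K = 0 :=
  Finset.sum_eq_zero fun j hj => emptyWeight_of_lt (by
    have := Finset.mem_range.1 hj; omega)

lemma binom_zero_left (k : ℤ) : binom 0 k = if k = 0 then 1 else 0 := by
  split_ifs with h
  · subst h; rfl
  · exact if_neg (by omega)

lemma binom_one_left (k : ℤ) : binom 1 k = if k = 0 ∨ k = 1 then 1 else 0 := by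
  split_ifs with h
  · rcases h with rfl | rfl <;> rfl
  · exact if_neg (by omega)

/-- The bulk case `M = K + n + 2`. In the induction step Pascal's rule cancels the terms `binom (n +
2) K`, and the rest reduces to row `n`. -/
lemma closed_form_aux (K n : ℕ) :
    1 / 4 * ∑ j ∈ Finset.range (K + (n + 2)), emptyWeight j K
        + 1 / 2 * emptyWeight (K + (n + 2)) K
      = 3 / 8 * (if K = 0 then 1 else 0) + binom n (K - 1) / 2 ^ (n + 4)
        + 1 / 8 * ((∑ y ∈ Finset.Icc ((K : ℤ) - 2) n, binom n y : ℕ) / 2 ^ n)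
        + 3 / 16 * ∑ y ∈ Finset.range (n + 1), (binom y (K - 1) : ℝ) / 2 ^ y := by
  induction n with
  | zero =>
    have e0 := emptyWeight_add K 0
    have e1 := emptyWeight_add K 1
    have e2 := emptyWeight_add K 2
    have p2 := binom_succ 1 K
    simp only [Nat.cast_zero, Nat.cast_one] at e0 e1 p2
    rw [show ((1 : ℤ) + 1) = ((2 : ℕ) : ℤ) by norm_num] at p2
    rw [zero_add, Finset.sum_range_succ, Finset.sum_range_succ, sum_emptyWeight_self, e2, p2]
    change 1 / 4 * (0 + emptyWeight (K + 0) K + _) + _ = _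
    rw [e0, e1]
    simp only [Nat.cast_zero, zero_add, Finset.sum_range_one, binom_zero_left, binom_one_left]
    -- At `n = 0` all binomial terms vanish once `K ≥ 3`, leaving three numerical cases.
    rcases K with _ | _ | _ | K
    · norm_num
    · norm_num
    · norm_num
    · have a1 : ¬ ((K : ℤ) + 1 + 1 + 1 = 0) := by omega
      have a2 : ¬ ((K : ℤ) + 1 + 1 = 0) := by omega
      have a3 : ¬ ((K : ℤ) + 1 = 0) := by omega
      have a4 : ¬ ((K : ℤ) < 0) := by omega
      push_cast
      simp [a1, a2, a3, a4]
  | succ n ih =>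
    have p1 := binom_succ n ((K : ℤ) - 1)
    have p2 := binom_succ (n + 1) ((K : ℤ) - 1)
    have p3 := binom_succ n ((K : ℤ) - 2)
    have p4 := binom_succ (n + 2) (K : ℤ)
    rw [show (K : ℤ) - 1 - 1 = K - 2 by ring] at p1 p2
    have hs := sum_binom_succ n ((K : ℤ) - 2)
    have e2 := emptyWeight_add K (n + 2)
    have e3 := emptyWeight_add K (n + 3)
    rw [show K + (n + 1 + 2) = K + (n + 2) + 1 by ring, Finset.sum_range_succ,
      Finset.sum_range_succ _ (n + 1)]
    rw [show K + (n + 2) + 1 = K + (n + 3) by ring, e3]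
    rw [e2] at ih ⊢
    push_cast at p1 p2 p3 p4 hs ih ⊢
    rw [show (n : ℤ) + 2 + 1 = n + 3 by ring] at p4
    rw [show (n : ℤ) + 1 + 1 = n + 2 by ring] at p2
    have q1 := congrArg (Nat.cast (R := ℝ)) p1
    have q2 := congrArg (Nat.cast (R := ℝ)) p2
    have q3 := congrArg (Nat.cast (R := ℝ)) p3
    have q4 := congrArg (Nat.cast (R := ℝ)) p4
    have q5 := congrArg (Nat.cast (R := ℝ)) hs
    push_cast at q1 q2 q3 q4 q5
    rw [q1, q5, q4, q2, q1, q3]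
    rw [show (K : ℤ) - 2 - 1 = K - 3 by ring] at *
    rw [mul_add, add_right_comm, eq_sub_of_add_eq ih]
    field_simp
    ring

lemma sum_Icc_zero_int (N : ℕ) (f : ℤ → ℝ) :
    ∑ y ∈ Finset.Icc (0 : ℤ) (N - 1), f y = ∑ i ∈ Finset.range N, f i := by
  symm
  refine Finset.sum_bij (fun i _ => (i : ℤ)) ?_ ?_ ?_ ?_
  · intro i hi
    have := Finset.mem_range.1 hi
    exact Finset.mem_Icc.2 ⟨by omega, by omega⟩
  · intro i _ j _ h
    exact_mod_cast h
  · intro y hy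
    have := Finset.mem_Icc.1 hy
    exact ⟨y.toNat, Finset.mem_range.2 (by omega), by omega⟩
  · intro i _; rfl

lemma emptyWeight_eq_zpow (M y : ℕ) :
    emptyWeight M y = (2 : ℝ) ^ (-((M : ℤ) - y)) * binom (M - y) y := by
  rcases Nat.lt_or_ge M y with h | h
  · rw [binom_of_neg (by omega), emptyWeight_of_lt (by omega)]; simp
  · obtain ⟨i, rfl⟩ := Nat.exists_eq_add_of_le h
    rw [emptyWeight_add]
    push_cast
    rw [add_sub_cancel_left, zpow_neg, zpow_natCast]
    ring

lemma r_succ (M K : ℕ) : r (M + 1) (M + 1 + K)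
    = (1 / 4 * ∑ j ∈ Finset.range M, emptyWeight j K + 1 / 2 * emptyWeight M K)
      + 1 / 2 * ∑ y ∈ Finset.range K, emptyWeight M y := by
  have := r_eq_probs (M + 1) K
  rw [one_sub_belowProb, moverProb_succ_eq, Finset.sum_range_succ] at this
  push_cast at this
  rw [this]; ring

/-- For `M < K + 2` the `θ` term and the two sums on the right vanish, and the Kronecker deltas
supply the few nonzero values; otherwise `closed_form_aux` applies. -/
lemma closed_form (M K : ℕ) :
    1 / 4 * ∑ j ∈ Finset.range M, emptyWeight j K + 1 / 2 * emptyWeight M K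
      = 3 / 8 * (if K = 0 then 1 else 0)
        + 1 / 8 * ((if M = 0 ∧ K = 0 then 1 else 0) + (if M = 1 ∧ K = 0 then 1 else 0))
        + 1 / 4 * (if M = 2 ∧ K = 1 then 1 else 0)
        + (if (0 : ℤ) ≤ M - K - 2 then 1 else 0)
          * (2 : ℝ) ^ ((K : ℤ) - M - 2) * binom (M - K - 2) (K - 1)
        + 1 / 8 * ∑ y ∈ Finset.Icc ((K : ℤ) - 2) (M - K - 2),
            (2 : ℝ) ^ (-((M : ℤ) - K - 2)) * binom (M - K - 2) y
        + 3 / 16 * ∑ y ∈ Finset.Icc (0 : ℤ) (M - K - 2),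
            (2 : ℝ) ^ (-y) * binom y (K - 1) := by
  rcases Nat.lt_or_ge M (K + 2) with h | h
  · rw [if_neg (show ¬ (0 : ℤ) ≤ M - K - 2 by omega),
      Finset.Icc_eq_empty (show ¬ (0 : ℤ) ≤ M - K - 2 by omega)]
    simp only [binom_of_neg (show (M : ℤ) - K - 2 < 0 by omega)]
    have e0 := emptyWeight_add K 0
    have e1 := emptyWeight_add K 1
    simp only [Nat.cast_zero, Nat.cast_one, binom_zero_left, binom_one_left, add_zero] at e0 e1
    rcases Nat.lt_or_ge M K with h1 | h1
    · have hsum : ∑ j ∈ Finset.range M, emptyWeight j K = 0 :=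
        Finset.sum_eq_zero fun j hj => emptyWeight_of_lt (by
          have := Finset.mem_range.1 hj; omega)
      rw [hsum, emptyWeight_of_lt (by omega), if_neg (by omega), if_neg (by omega),
        if_neg (by omega), if_neg (by omega)]
      simp
    · obtain rfl | rfl : M = K ∨ M = K + 1 := by omega
      · rw [sum_emptyWeight_self, e0, if_neg (show ¬ (M = 1 ∧ M = 0) by omega),
          if_neg (show ¬ (M = 2 ∧ M = 1) by omega)]
        by_cases hM : M = 0
        · simp [hM]; norm_num
        · simp [hM]
      · rw [Finset.sum_range_succ, sum_emptyWeight_self, e0, e1]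
        rcases K with _ | _ | K
        · norm_num
        · norm_num
        · have a1 : ¬ ((K : ℤ) + 1 + 1 = 0) := by omega
          have a2 : ¬ ((K : ℤ) + 1 + 1 = 1) := by omega
          have a3 : ¬ ((K : ℤ) + 1 = 0) := by omega
          push_cast
          simp [a1, a3]
  · obtain ⟨n, rfl⟩ := Nat.exists_eq_add_of_le h
    have hM : K + 2 + n = K + (n + 2) := by ring
    have hn : ((K + 2 + n : ℕ) : ℤ) - K - 2 = n := by push_cast; ring
    have hz : (K : ℤ) - ((K + 2 + n : ℕ) : ℤ) - 2 = -((n + 4 : ℕ) : ℤ) := by push_cast; ring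
    have hs := sum_Icc_zero_int (n + 1) fun y => (2 : ℝ) ^ (-y) * binom y (K - 1)
    push_cast at hs
    rw [add_sub_cancel_right] at hs
    rw [hn, hz, hs, hM, closed_form_aux, if_neg (show ¬ (K + (n + 2) = 0 ∧ K = 0) by omega),
      if_neg (show ¬ (K + (n + 2) = 1 ∧ K = 0) by omega),
      if_neg (show ¬ (K + (n + 2) = 2 ∧ K = 1) by omega), if_pos (show (0 : ℤ) ≤ n by omega), ← Finset.mul_sum]
    simp only [zpow_neg, zpow_natCast]
    push_cast
    simp only [div_eq_inv_mul]
    ring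

theorem r_exact (m : ℤ) (t : ℕ) (h1 : 1 ≤ m) (h2 : m ≤ t) :
    r m t =
        3 / 8 * (if m = t then 1 else 0)
        + 1 / 8 * ((if m = 1 ∧ t = 1 then 1 else 0) + (if m = 2 ∧ t = 2 then 1 else 0))
        + 1 / 4 * (if m = 3 ∧ t = 4 then 1 else 0)
        + (if 0 ≤ 2 * m - t - 3 then 1 else 0)
          * (2 : ℝ) ^ ((t : ℤ) - 2 * m - 1) * binom (2 * m - t - 3) (t - m - 1)
        + 1 / 8 * ∑ y ∈ Finset.Icc ((t : ℤ) - m - 2) (2 * m - t - 3),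
            (2 : ℝ) ^ (-(2 * m - t - 3)) * binom (2 * m - t - 3) y
        + 3 / 16 * ∑ y ∈ Finset.Icc (0 : ℤ) (2 * m - t - 3),
            (2 : ℝ) ^ (-y) * binom y (t - m - 1)
        + 1 / 2 * ∑ y ∈ Finset.Icc (0 : ℤ) (t - m - 1),
            (2 : ℝ) ^ (-(m - 1 - y)) * binom (m - 1 - y) y := by
  obtain ⟨M, rfl⟩ : ∃ M : ℕ, m = M + 1 := ⟨(m - 1).toNat, by omega⟩
  obtain ⟨K, rfl⟩ : ∃ K : ℕ, t = M + 1 + K := ⟨t - (M + 1), by omega⟩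
  have hs := sum_Icc_zero_int K fun y => (2 : ℝ) ^ (-((M : ℤ) - y)) * binom (M - y) y
  simp only [← emptyWeight_eq_zpow] at hs
  have i1 : (M : ℤ) + 1 = ((M + 1 + K : ℕ) : ℤ) ↔ K = 0 := by omega
  have i2 : (M : ℤ) + 1 = 1 ∧ M + 1 + K = 1 ↔ M = 0 ∧ K = 0 := by omega
  have i3 : (M : ℤ) + 1 = 2 ∧ M + 1 + K = 2 ↔ M = 1 ∧ K = 0 := by omega
  have i4 : (M : ℤ) + 1 = 3 ∧ M + 1 + K = 4 ↔ M = 2 ∧ K = 1 := by omega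
  have j1 : 2 * ((M : ℤ) + 1) - ((M + 1 + K : ℕ) : ℤ) - 3 = M - K - 2 := by push_cast; ring
  have j2 : ((M + 1 + K : ℕ) : ℤ) - 2 * ((M : ℤ) + 1) - 1 = K - M - 2 := by push_cast; ring
  have j3 : ((M + 1 + K : ℕ) : ℤ) - ((M : ℤ) + 1) - 1 = K - 1 := by push_cast; ring
  have j4 : ((M + 1 + K : ℕ) : ℤ) - ((M : ℤ) + 1) - 2 = K - 2 := by push_cast; ring
  simp only [i1, i2, i3, i4, j1, j2, j3, j4, add_sub_cancel_right]
  rw [hs, r_succ, closed_form]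

/-! ### The number of occupied sites next to the junction -/

/-- The number of occupied sites among `0, -1, …, -(n - 1)`. -/
def occCount (n : ℕ) (s : Config) : ℕ := ∑ k ∈ Finset.range n, (s (-(k : ℤ))).val

lemma measurable_occCount (n : ℕ) : Measurable (occCount n) := by
  have h (k : ℕ) : Measurable fun s : Config => (s (-(k : ℤ))).val := by
    have hv : Measurable (ZMod.val : ZMod 2 → ℕ) := Measurable.of_discrete
    exact hv.comp (measurable_pi_apply _)
  unfold occCount
  exact Finset.measurable_fun_sum _ fun k _ => h k

lemma occCount_update (n : ℕ) (s : Config) (b : ZMod 2) :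
    occCount (n + 1) (Function.update s (-(n : ℤ)) b) = occCount n s + b.val := by
  rw [occCount, Finset.sum_range_succ, Function.update_self, occCount]
  congr 1
  refine Finset.sum_congr rfl fun k hk => ?_
  have := Finset.mem_range.1 hk
  rw [Function.update_of_ne (by omega)]

lemma integrable_occCount (n : ℕ) {f : ℕ → ℝ} {C : ℝ} (hf : ∀ k, |f k| ≤ C) :
    Integrable (fun s => f (occCount n s)) (halfFilled 0) :=
  Integrable.of_bound ((Measurable.of_discrete (f := f)).comp
    (measurable_occCount n)).aestronglyMeasurable C (ae_of_all _ fun _ => hf _)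

lemma integral_occCount_succ (n : ℕ) {f : ℕ → ℝ} {C : ℝ} (hf : ∀ k, |f k| ≤ C) :
    ∫ s, f (occCount (n + 1) s) ∂(halfFilled 0)
      = (∫ s, f (occCount n s) ∂(halfFilled 0) + ∫ s, f (occCount n s + 1) ∂(halfFilled 0)) / 2 := by
  have hm : Measurable fun s => f (occCount (n + 1) s) :=
    (Measurable.of_discrete (f := f)).comp (measurable_occCount _)
  rw [integral_halfFilled_update (y := -(n : ℤ)) (by omega) hm fun s => hf _]
  simp only [occCount_update]
  rfl

lemma abs_ite_le (p : Prop) [Decidable p] : |if p then (1 : ℝ) else 0| ≤ 1 := by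
  split_ifs <;> simp

lemma integral_occCount_eq (n j : ℕ) :
    ∫ s, (if occCount n s = j then (1 : ℝ) else 0) ∂(halfFilled 0) = n.choose j / 2 ^ n := by
  induction n generalizing j with
  | zero => cases j <;> simp [occCount]
  | succ n ih =>
    rw [integral_occCount_succ n (f := fun k => if k = j then (1 : ℝ) else 0) fun k => abs_ite_le _,
      ih]
    cases j with
    | zero => simp [pow_succ]; ring
    | succ j =>
      simp only [add_left_inj, ih, Nat.choose_succ_succ, pow_succ]
      push_cast
      ring

/-- First passage: the count exceeds `K` for the first time when it equals `K` and the next site is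
occupied, which has probability `1/2`. -/
lemma integral_occCount_gt (n K : ℕ) :
    ∫ s, (if K < occCount n s then (1 : ℝ) else 0) ∂(halfFilled 0)
      = (∑ i ∈ Finset.range n, (i.choose K : ℝ) / 2 ^ i) / 2 := by
  induction n with
  | zero => simp [occCount]
  | succ n ih =>
    have hi1 := integrable_occCount n (f := fun k => if K < k then (1 : ℝ) else 0)
      fun k => abs_ite_le _
    have hi2 := integrable_occCount n (f := fun k => if k = K then (1 : ℝ) else 0)
      fun k => abs_ite_le _
    have h (k : ℕ) : (if K < k + 1 then (1 : ℝ) else 0)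
        = (if K < k then (1 : ℝ) else 0) + if k = K then (1 : ℝ) else 0 := by
      rcases lt_trichotomy k K with h | h | h
      · rw [if_neg (by omega), if_neg (by omega), if_neg (by omega)]; simp
      · rw [if_pos (by omega), if_neg (by omega), if_pos h]; simp
      · rw [if_pos (by omega), if_pos (by omega), if_neg (by omega)]; simp
    rw [integral_occCount_succ n (f := fun k => if K < k then (1 : ℝ) else 0)
      fun k => abs_ite_le _]
    simp only [h]
    rw [integral_add hi1 hi2, ih, integral_occCount_eq, Finset.sum_range_succ]
    ring

/-- Both sides are the same sum of `i.choose K / 2 ^ i`. The equality is one of probabilities only: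
the occupied sites merely serve as a ready supply of independent fair bits. -/
lemma belowProb_eq_measure (n K : ℕ) :
    belowProb (K + n + 1) K = 1 - (halfFilled 0).real {s | K < occCount n s} := by
  have hset : MeasurableSet {s | K < occCount n s} :=
    measurableSet_lt measurable_const (measurable_occCount n)
  have h1 := integral_occCount_gt n K
  have h2 := one_sub_belowProb (K + n) K
  have h3 : ∫ s, (if K < occCount n s then (1 : ℝ) else 0) ∂(halfFilled 0)
      = (halfFilled 0).real {s | K < occCount n s} := by
    rw [← integral_indicator_one hset]
    exact integral_congr_ae (ae_of_all _ fun s => by simp [Set.indicator_apply])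
  have h4 : ∑ j ∈ Finset.range (K + n), emptyWeight j K
      = ∑ i ∈ Finset.range n, (i.choose K : ℝ) / 2 ^ i := by
    rw [Finset.sum_range_add, sum_emptyWeight_self, zero_add]
    exact Finset.sum_congr rfl fun i _ => by rw [emptyWeight_add, binom_natCast]
  rw [← h3, h1, ← h4]
  linarith

/-! ### The central limit theorem for the number of occupied sites -/

open ProbabilityTheory in
lemma tendstoInDistribution_occCount :
    TendstoInDistribution (fun (n : ℕ) (s : Config) => (√(n : ℝ))⁻¹ * (2 * (occCount n s : ℝ) - n))
      atTop id (fun _ => halfFilled 0) (gaussianReal 0 1) := by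
  let g : ZMod 2 → ℝ := fun a => 2 * (a.val : ℝ) - 1
  let X : ℕ → Config → ℝ := fun k s => g (s (-(k : ℤ)))
  have g0 : g 0 = -1 := by simp [g]
  have g1 : g 1 = 1 := by
    simp only [g]; rw [show (1 : ZMod 2).val = 1 from rfl]; norm_num
  have hg : Measurable g := Measurable.of_discrete
  have hXm (k : ℕ) : Measurable (X k) := hg.comp (measurable_pi_apply _)
  have hsum : (fun (n : ℕ) (s : Config) => (√(n : ℝ))⁻¹ * (2 * (occCount n s : ℝ) - n))
      = fun (n : ℕ) s => (√(n : ℝ))⁻¹ * ∑ k ∈ Finset.range n, X k s := by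
    funext n s
    simp only [X, g, occCount, Finset.sum_sub_distrib, ← Finset.mul_sum]
    simp
  have hcases (a : ZMod 2) : a = 0 ∨ a = 1 := by revert a; decide
  have hgb (a : ZMod 2) : |g a| ≤ 1 := by
    rcases hcases a with rfl | rfl <;> simp [g0, g1]
  have h0 : ∫ s, X 0 s ∂(halfFilled 0) = 0 := by
    rw [integral_halfFilled_update (le_refl (0 : ℤ)) (hXm 0) fun s => hgb _]
    simp [X, avg, g0, g1]
  have h1 : ∫ s, (X 0 ^ 2) s ∂(halfFilled 0) = 1 := by
    have : (X 0 ^ 2) = fun _ => (1 : ℝ) := by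
      funext s
      rcases hcases (s (-((0 : ℕ) : ℤ))) with h | h <;> simp only [Pi.pow_apply, X, h, g0, g1] <;>
        norm_num
    rw [this]
    simp
  have hind : iIndepFun X (halfFilled 0) := by
    have := iIndepFun_infinitePi (P := fun y : ℤ =>
      (if y ≤ 0 then PMF.uniformOfFintype (ZMod 2) else PMF.pure 0 : PMF (ZMod 2)).toMeasure)
      (X := fun _ => g) fun _ => hg
    exact this.precomp (g := fun k : ℕ => -(k : ℤ)) fun a b h => by simpa using h
  have hid (i : ℕ) : IdentDistrib (X i) (X 0) (halfFilled 0) (halfFilled 0) := by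
    refine ⟨(hXm i).aemeasurable, (hXm 0).aemeasurable, ?_⟩
    have hmap (k : ℕ) : (halfFilled 0).map (X k)
        = (PMF.uniformOfFintype (ZMod 2)).toMeasure.map g := by
      have he := (measurePreserving_eval_infinitePi (fun y : ℤ =>
        (if y ≤ 0 then PMF.uniformOfFintype (ZMod 2) else PMF.pure 0 : PMF (ZMod 2)).toMeasure)
        (-(k : ℤ))).map_eq
      rw [if_pos (by omega)] at he
      rw [← he]
      exact (Measure.map_map hg (measurable_pi_apply (-(k : ℤ)))).symm
    rw [hmap, hmap]
  rw [hsum]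
  exact tendstoInDistribution_inv_sqrt_mul_sum HasLaw.id h0 h1 hind hid

open ProbabilityTheory in
lemma gaussianReal_Ioi (b : ℝ) :
    (gaussianReal 0 1).real (Set.Ioi b) = 1 / 2 * (1 - erf (b / √2)) := by
  have hexp (x : ℝ) : Real.exp (-(x / √2) ^ 2) = Real.exp (-(1 / 2) * x ^ 2) := by
    congr 1
    rw [div_pow, Real.sq_sqrt (by norm_num)]; ring
  have hint : Integrable fun x : ℝ => Real.exp (-(1 / 2) * x ^ 2) :=
    integrable_exp_neg_mul_sq (by norm_num)
  have hpdf : gaussianPDFReal 0 1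
      = fun x => (√(2 * Real.pi))⁻¹ * Real.exp (-(1 / 2) * x ^ 2) := by
    funext x
    rw [gaussianPDFReal]
    congr 2
    · simp
    · simp; ring
  have hsplit := intervalIntegral.integral_interval_add_Ioi (a := 0) (b := b)
    hint.integrableOn hint.integrableOn
  rw [integral_gaussian_Ioi] at hsplit
  have hsub : (√2)⁻¹ * ∫ x in (0 : ℝ)..b, Real.exp (-(1 / 2) * x ^ 2)
      = ∫ u in (0 : ℝ)..b / √2, Real.exp (-u ^ 2) := by
    have := intervalIntegral.inv_mul_integral_comp_div (a := 0) (b := b)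
      (f := fun u => Real.exp (-u ^ 2)) (√2)
    simpa only [hexp, zero_div] using this
  have hpos : 0 ≤ ∫ x in Set.Ioi b, gaussianPDFReal 0 1 x :=
    integral_nonneg fun x => gaussianPDFReal_nonneg _ _ _
  rw [measureReal_def, gaussianReal_apply_eq_integral 0 one_ne_zero, ENNReal.toReal_ofReal hpos,
    hpdf, integral_const_mul, eq_sub_of_add_eq' hsplit, erf, ← hsub]
  have h2 : √(Real.pi / (1 / 2)) = √2 * √Real.pi := by
    rw [← Real.sqrt_mul (by norm_num)]; congr 1; ring
  rw [h2, Real.sqrt_mul (by norm_num)]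
  have p1 : √2 ≠ 0 := by positivity
  have p2 : √Real.pi ≠ 0 := by positivity
  have p3 : √2 ^ 2 = 2 := Real.sq_sqrt (by norm_num)
  field_simp

lemma continuous_erf : Continuous erf := by
  unfold erf
  refine continuous_const.mul ?_
  exact intervalIntegral.continuous_primitive
    (fun a b => Continuous.intervalIntegrable (by fun_prop) a b) 0

open ProbabilityTheory in
-- The rescaled threshold moves with `t`. Monotonicity compares it with fixed thresholds `b` on
-- either side of `a`, and continuity of the Gaussian tail closes the gap.
lemma tendsto_measure_occCount {n K : ℕ → ℕ} {a : ℝ} (hn : Tendsto n atTop atTop)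
    (hK : Tendsto (fun t => (√(n t : ℝ))⁻¹ * (2 * (K t : ℝ) - n t)) atTop (𝓝 a)) :
    Tendsto (fun t => (halfFilled 0).real {s | K t < occCount (n t) s}) atTop
      (𝓝 (1 / 2 * (1 - erf (a / √2)))) := by
  have hclt := tendstoInDistribution_occCount
  have hfix (b : ℝ) : Tendsto (fun t => (halfFilled 0).real
      {s | b < (√(n t : ℝ))⁻¹ * (2 * (occCount (n t) s : ℝ) - n t)}) atTop
      (𝓝 (1 / 2 * (1 - erf (b / √2)))) := by
    have hfr : (gaussianReal 0 1).map id (frontier (Set.Ioi b)) = 0 := by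
      have := nullSingletonClass_gaussianReal (μ := 0) (v := 1) one_ne_zero
      rw [frontier_Ioi, Measure.map_id]
      exact measure_singleton b
    have h1 := ProbabilityMeasure.tendsto_measure_of_null_frontier_of_tendsto' hclt.tendsto
      (E := Set.Ioi b) hfr
    have h2 := (ENNReal.tendsto_toReal
      (by simp)).comp (h1.comp hn)
    rw [← gaussianReal_Ioi]
    convert h2 using 2 with t
    · simp only [Function.comp_apply, ProbabilityMeasure.coe_mk]
      rw [Measure.map_apply_of_aemeasurable (hclt.forall_aemeasurable _) measurableSet_Ioi]
      rfl
    · simp [measureReal_def]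
  have hcont : Continuous fun b : ℝ => 1 / 2 * (1 - erf (b / √2)) := by
    have := continuous_erf
    fun_prop
  have hev : ∀ᶠ t in atTop, 0 < √(n t : ℝ) := by
    filter_upwards [hn.eventually_gt_atTop 0] with t ht
    exact Real.sqrt_pos.2 (by exact_mod_cast ht)
  have hiff (t : ℕ) (ht : 0 < √(n t : ℝ)) (s : Config) : K t < occCount (n t) s ↔
      (√(n t : ℝ))⁻¹ * (2 * (K t : ℝ) - n t)
        < (√(n t : ℝ))⁻¹ * (2 * (occCount (n t) s : ℝ) - n t) := by
    rw [mul_lt_mul_iff_right₀ (inv_pos.2 ht)]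
    constructor
    · intro h
      have : (K t : ℝ) < occCount (n t) s := by exact_mod_cast h
      linarith
    · intro h
      have : (K t : ℝ) < occCount (n t) s := by linarith
      exact_mod_cast this
  refine tendsto_order.2 ⟨fun l hl => ?_, fun u hu => ?_⟩
  · obtain ⟨b, hab, hb⟩ : ∃ b, a < b ∧ l < 1 / 2 * (1 - erf (b / √2)) :=
      ((frequently_gt_nhds a).and_eventually
        (hcont.continuousAt.eventually (lt_mem_nhds hl))).exists
    filter_upwards [hev, (hfix b).eventually (lt_mem_nhds hb), hK.eventually (gt_mem_nhds hab)]
      with t ht h1 h2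
    refine h1.trans_le (measureReal_mono fun s hs => ?_)
    exact (hiff t ht s).2 (h2.trans hs)
  · obtain ⟨b, hab, hb⟩ : ∃ b, b < a ∧ 1 / 2 * (1 - erf (b / √2)) < u :=
      ((frequently_lt_nhds a).and_eventually
        (hcont.continuousAt.eventually (gt_mem_nhds hu))).exists
    filter_upwards [hev, (hfix b).eventually (gt_mem_nhds hb), hK.eventually (lt_mem_nhds hab)]
      with t ht h1 h2
    refine lt_of_le_of_lt (measureReal_mono fun s hs => ?_) h1
    exact h2.trans ((hiff t ht s).1 hs)

/-! ### Asymptotic independence -/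

lemma emptyWeight_nonneg (m k : ℕ) : 0 ≤ emptyWeight m k := by unfold emptyWeight; positivity

lemma moverWeight_nonneg (m k : ℕ) : 0 ≤ moverWeight m k := by
  cases m with
  | zero => exact le_rfl
  | succ m => exact div_nonneg (emptyWeight_nonneg m k) zero_le_two

lemma belowProb_succ_le (m K : ℕ) : belowProb (m + 1) K ≤ belowProb m K := by
  rw [belowProb_succ]; linarith [moverWeight_nonneg m K]

lemma belowProb_antitone (K : ℕ) : Antitone fun m => belowProb m K :=
  antitone_nat_of_succ_le fun m => belowProb_succ_le m K

lemma belowProb_le_one (m K : ℕ) : belowProb m K ≤ 1 :=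
  (belowProb_antitone K m.zero_le).trans_eq (belowProb_zero K)

lemma moverProb_nonneg (m K : ℕ) : 0 ≤ moverProb m K :=
  Finset.sum_nonneg fun k _ => moverWeight_nonneg m k

lemma moverProb_le_belowProb (m K : ℕ) : moverProb m K ≤ belowProb m K :=
  Finset.sum_le_sum fun k _ => by linarith [emptyWeight_nonneg m k]

/-- If `belowProb` were constant, each step would multiply the deviation from one third by `-1/2`.
The second term bounds the error from its decrease. -/
lemma abs_moverProb_sub_le (m i K : ℕ) :
    |moverProb (m + i) K - belowProb (m + i) K / 3|
      ≤ (1 / 2) ^ i + (belowProb m K - belowProb (m + i) K) := by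
  induction i with
  | zero =>
    have h1 := belowProb_le_one m K
    have h2 := moverProb_nonneg m K
    have h3 := moverProb_le_belowProb m K
    rw [add_zero, sub_self, add_zero, pow_zero, abs_le]
    constructor <;> linarith
  | succ i ih =>
    have h1 := belowProb_succ_le (m + i) K
    have h4 : (0 : ℝ) < (1 / 2) ^ i := by positivity
    rw [abs_le] at ih ⊢
    rw [← add_assoc, moverProb_succ, pow_succ]
    have h5 : belowProb (m + i) K ≤ belowProb m K := belowProb_antitone K (Nat.le_add_right m i)
    constructor <;> linarith [ih.1, ih.2]

/-! ### The diffusive scale -/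

lemma tendsto_atTop_of_div {n : ℕ → ℕ} (hn : Tendsto (fun t : ℕ => (n t : ℝ) / t) atTop (𝓝 (1 / 2))) :
    Tendsto n atTop atTop := by
  rw [← tendsto_natCast_atTop_iff (R := ℝ)]
  refine (hn.pos_mul_atTop (by norm_num) tendsto_natCast_atTop_atTop).congr' ?_
  filter_upwards [eventually_gt_atTop 0] with t ht
  have : (t : ℝ) ≠ 0 := by positivity
  field_simp

lemma tendsto_belowProb {ζ : ℝ} {n K : ℕ → ℕ}
    (hn : Tendsto (fun t : ℕ => (n t : ℝ) / t) atTop (𝓝 (1 / 2)))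
    (hK : Tendsto (fun t : ℕ => (2 * (K t : ℝ) - n t) / √(t : ℝ)) atTop (𝓝 (2 * ζ))) :
    Tendsto (fun t => belowProb (K t + n t + 1) (K t)) atTop
      (𝓝 (1 - 1 / 2 * (1 - erf (2 * ζ)))) := by
  have hs : Tendsto (fun t : ℕ => √((n t : ℝ) / t)) atTop (𝓝 √(1 / 2)) :=
    (Real.continuous_sqrt.tendsto _).comp hn
  have hdiv := hK.div hs (by positivity)
  have hlim : Tendsto (fun t => (√(n t : ℝ))⁻¹ * (2 * (K t : ℝ) - n t)) atTop
      (𝓝 (2 * ζ / √(1 / 2))) := by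
    refine hdiv.congr' ?_
    filter_upwards [eventually_gt_atTop 0] with t ht
    have : √(t : ℝ) ≠ 0 := by positivity
    rw [Pi.div_apply, Real.sqrt_div (Nat.cast_nonneg _)]
    field_simp
  have h := tendsto_measure_occCount (tendsto_atTop_of_div hn) hlim
  have ha : 2 * ζ / √(1 / 2) / √2 = 2 * ζ := by
    rw [div_div, ← Real.sqrt_mul (by norm_num)]
    norm_num
  rw [ha] at h
  simp only [belowProb_eq_measure]
  exact h.const_sub 1

lemma tendsto_moverProb_sub {ζ : ℝ} {n K : ℕ → ℕ}
    (hn : Tendsto (fun t : ℕ => (n t : ℝ) / t) atTop (𝓝 (1 / 2)))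
    (hK : Tendsto (fun t : ℕ => (2 * (K t : ℝ) - n t) / √(t : ℝ)) atTop (𝓝 (2 * ζ))) :
    Tendsto (fun t => moverProb (K t + n t + 1) (K t) - belowProb (K t + n t + 1) (K t) / 3)
      atTop (𝓝 0) := by
  rw [Metric.tendsto_atTop']
  intro ε hε
  obtain ⟨i, hi⟩ := exists_pow_lt_of_lt_one (half_pos hε) (show (1 / 2 : ℝ) < 1 by norm_num)
  have hni := (tendsto_atTop_of_div hn).eventually_ge_atTop i
  -- Going back a fixed number `i` of rays is invisible on the diffusive scale, so `belowProb` has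
  -- the same limit at both ends and its decrease vanishes.
  have hn' : Tendsto (fun t : ℕ => ((n t - i : ℕ) : ℝ) / t) atTop (𝓝 (1 / 2)) := by
    have h0 : Tendsto (fun t : ℕ => (i : ℝ) / t) atTop (𝓝 0) :=
      tendsto_const_nhds.div_atTop tendsto_natCast_atTop_atTop
    have h1 := hn.sub h0
    rw [sub_zero] at h1
    refine h1.congr' ?_
    filter_upwards [hni] with t ht
    rw [Nat.cast_sub ht, sub_div]
  have hK' : Tendsto (fun t : ℕ => (2 * (K t : ℝ) - (n t - i : ℕ)) / √(t : ℝ)) atTop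
      (𝓝 (2 * ζ)) := by
    have h0 : Tendsto (fun t : ℕ => (i : ℝ) / √(t : ℝ)) atTop (𝓝 0) :=
      tendsto_const_nhds.div_atTop (Real.tendsto_sqrt_atTop.comp tendsto_natCast_atTop_atTop)
    have h1 := hK.add h0
    rw [add_zero] at h1
    refine h1.congr' ?_
    filter_upwards [hni] with t ht
    rw [Nat.cast_sub ht]; ring
  have hd := (tendsto_belowProb hn' hK').sub (tendsto_belowProb hn hK)
  rw [sub_self] at hd
  have hev := hd.eventually (gt_mem_nhds (half_pos hε))
  obtain ⟨N, hN⟩ := eventually_atTop.1 (hni.and hev)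
  refine ⟨N, fun t ht => ?_⟩
  obtain ⟨h1, h2⟩ := hN t ht.le
  have h3 := abs_moverProb_sub_le (K t + (n t - i) + 1) i (K t)
  rw [show K t + (n t - i) + 1 + i = K t + n t + 1 by omega] at h3
  rw [Real.dist_eq, sub_zero]
  linarith

lemma profile_succ_of_even {x : ℤ} {t : ℕ} (h : Even (x + (t + 1 : ℕ))) :
    profile x (t + 1) = profile x t := by
  simp only [profile_eq_integral, evolve_succ_of_even h]

/-- The two times share one value because site `x` is not updated in the step between them. -/
lemma profile_eq_probs {x : ℤ} {t n K : ℕ} (hx : x = -n)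
    (ht : t = 2 * K + n + 1 ∨ t = 2 * K + n + 2) :
    profile x t = (1 - belowProb (K + n + 1) K) / 2 + moverProb (K + n + 1) K := by
  rw [← r_eq_probs]
  rcases ht with rfl | rfl
  · rw [profile_eq_r (m := (K + n + 1 : ℕ)) (by rw [hx]; push_cast; ring)]
    congr 1; omega
  · rw [profile_succ_of_even ⟨K + 1, by rw [hx]; push_cast; ring⟩,
      profile_eq_r (m := (K + n + 1 : ℕ)) (by rw [hx]; push_cast; ring)]
    congr 1; omega

theorem tendsto_profile (ζ : ℝ) (x : ℕ → ℤ)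
    (hx : Tendsto (fun t : ℕ => ((x t : ℝ) + t / 2) / √(t : ℝ)) atTop (𝓝 ζ)) :
    Tendsto (fun t : ℕ => profile (x t) t) atTop (𝓝 (1 / 12 * (5 - erf (2 * ζ)))) := by
  have hsq : Tendsto (fun t : ℕ => √(t : ℝ)) atTop atTop :=
    Real.tendsto_sqrt_atTop.comp tendsto_natCast_atTop_atTop
  have hx1 : Tendsto (fun t : ℕ => (x t : ℝ) / t) atTop (𝓝 (-(1 / 2))) := by
    have h := (hx.div_atTop hsq).sub_const (1 / 2 : ℝ)
    rw [zero_sub] at h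
    refine h.congr' ?_
    filter_upwards [eventually_gt_atTop 0] with t ht
    have h1 : (t : ℝ) ≠ 0 := by positivity
    rw [div_div, Real.mul_self_sqrt (Nat.cast_nonneg t)]
    field_simp
    ring
  set n : ℕ → ℕ := fun t => (-x t).toNat with hndef
  set K : ℕ → ℕ := fun t => (((t : ℤ) + x t - 1) / 2).toNat with hKdef
  have hev : ∀ᶠ t : ℕ in atTop, x t ≤ 0 ∧ 1 ≤ (t : ℤ) + x t := by
    have h1 := hx1.eventually (gt_mem_nhds (show -(1 / 2 : ℝ) < 0 by norm_num))
    have h2 := hx1.eventually (lt_mem_nhds (show (-1 : ℝ) < -(1 / 2) by norm_num))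
    filter_upwards [h1, h2, eventually_gt_atTop 0] with t h1 h2 ht
    have ht' : (0 : ℝ) < t := by positivity
    rw [div_lt_iff₀ ht', zero_mul] at h1
    rw [lt_div_iff₀ ht'] at h2
    have h1' : x t < 0 := by exact_mod_cast h1
    have h2' : -1 * (t : ℤ) < x t := by exact_mod_cast h2
    constructor <;> omega
  have hnx : ∀ᶠ t : ℕ in atTop, x t = -(n t : ℤ) := by
    filter_upwards [hev] with t ht
    simp only [hndef]; omega
  have hKt : ∀ᶠ t : ℕ in atTop, t = 2 * K t + n t + 1 ∨ t = 2 * K t + n t + 2 := by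
    filter_upwards [hev] with t ht
    simp only [hndef, hKdef]; omega
  have hn : Tendsto (fun t : ℕ => (n t : ℝ) / t) atTop (𝓝 (1 / 2)) := by
    have h := hx1.neg
    rw [neg_neg] at h
    refine h.congr' ?_
    filter_upwards [hnx] with t ht
    rw [ht]; push_cast; ring
  -- Since `n = -x` and `2 * K` is `t + x` up to a bounded error, `2 * K - n` is `2 * (x + t / 2)`
  -- up to at most `2`.
  have hK : Tendsto (fun t : ℕ => (2 * (K t : ℝ) - n t) / √(t : ℝ)) atTop (𝓝 (2 * ζ)) := by
    have hb : Tendsto (fun t : ℕ => (2 * (K t : ℝ) - n t - 2 * (x t + t / 2)) / √(t : ℝ)) atTop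
        (𝓝 0) := by
      refine squeeze_zero_norm' ?_ (tendsto_const_nhds.div_atTop hsq : Tendsto
        (fun t : ℕ => (2 : ℝ) / √(t : ℝ)) atTop (𝓝 0))
      filter_upwards [hnx, hKt] with t h1 h2
      rw [norm_div, Real.norm_of_nonneg (Real.sqrt_nonneg _), Real.norm_eq_abs]
      gcongr
      have h1' : (x t : ℝ) = -(n t : ℝ) := by rw [h1]; push_cast; ring
      rw [h1', abs_le]
      rcases h2 with h2 | h2
      · have h2' : (t : ℝ) = 2 * K t + n t + 1 := by exact_mod_cast h2
        constructor <;> linarith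
      · have h2' : (t : ℝ) = 2 * K t + n t + 2 := by exact_mod_cast h2
        constructor <;> linarith
    have h := (hx.const_mul 2).add hb
    rw [add_zero] at h
    exact h.congr fun t => by ring
  have hB := tendsto_belowProb hn hK
  have hA := tendsto_moverProb_sub hn hK
  have h := ((hB.const_sub 1).div_const 2).add (hA.add (hB.div_const 3))
  have hlim : (1 - (1 - 1 / 2 * (1 - erf (2 * ζ)))) / 2
      + (0 + (1 - 1 / 2 * (1 - erf (2 * ζ))) / 3) = 1 / 12 * (5 - erf (2 * ζ)) := by ring
  rw [hlim] at h
  refine h.congr' ?_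
  filter_upwards [hnx, hKt] with t h1 h2
  rw [profile_eq_probs h1 h2]
  ring

/-! ### Outside of the light-cone, and the region of right-movers -/

/-- Every component of the mixture starts with at least `m + 1` uniform bits. -/
lemma rayE_occ_of_le {m j : ℕ} (h : j ≤ m) : (rayE m fun u => occ (u j)) = 1 / 2 := by
  have hw := sum_weights m (m + 1) (by omega)
  rw [rayE_eq_sum m (m + 1) (by omega), eq_comm, ← one_mul (1 / 2 : ℝ)]
  nth_rw 1 [← hw]
  rw [Finset.sum_mul]
  refine Finset.sum_congr rfl fun k _ => ?_
  rw [tailE_occ, tailE_occ, if_pos (by omega), if_pos (by omega)]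
  ring

theorem profile_left_of_lightcone {x : ℤ} {t : ℕ} (h : x < -(t : ℤ)) : profile x t = 1 / 2 := by
  rcases Int.even_or_odd' ((t : ℤ) - x) with ⟨c, hc | hc⟩
  · obtain ⟨m, rfl⟩ : ∃ m : ℕ, c = m := ⟨c.toNat, by omega⟩
    rw [show x = t - 2 * (m : ℤ) by omega, profile_even, rayE_occ_of_le (by omega)]
  · obtain ⟨m, hm⟩ : ∃ m : ℕ, c + 1 = m := ⟨(c + 1).toNat, by omega⟩
    rw [show x = t + 1 - 2 * (m : ℤ) by omega, profile_odd, rayE_occ_of_le (by omega)]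

/-- In both parities the bound `-t < 3 * x` amounts to `m ≤ 2 * K + 1`, where no ray can have more
than `K` right-movers before it. -/
theorem profile_of_right_movers {x : ℤ} {t : ℕ} (h1 : -(t : ℤ) < 3 * x) (h2 : x ≤ t) :
    profile x t = 1 / 3 * (1 - (-1 / 2 : ℝ) ^ (((t : ℤ) - x + 1) / 2)) := by
  obtain ⟨m, hm⟩ : ∃ m : ℕ, ((t : ℤ) - x + 1) / 2 = m := ⟨(((t : ℤ) - x + 1) / 2).toNat, by omega⟩
  rw [hm, zpow_natCast]
  rcases Int.even_or_odd' ((t : ℤ) - x) with ⟨c, hc | hc⟩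
  · obtain ⟨K, rfl⟩ : ∃ K, t = m + K + 1 := ⟨t - m - 1, by omega⟩
    rw [profile_succ_of_even ⟨x + c, by omega⟩, profile_eq_r (m := m) (by omega),
      r_of_right_movers (by omega)]
  · obtain ⟨K, rfl⟩ : ∃ K, t = m + K := ⟨t - m, by omega⟩
    rw [profile_eq_r (m := m) (by omega), r_of_right_movers (by omega)]

lemma floor_intCast_div_two (a : ℤ) : ⌊(a : ℝ) / 2⌋ = a / 2 := by
  rw [Int.floor_eq_iff]
  have h1 : ((2 * (a / 2) : ℤ) : ℝ) ≤ a := by exact_mod_cast Int.mul_ediv_self_le (by norm_num)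
  have h2 : (a : ℝ) < (2 * (a / 2) + 2 : ℤ) := by
    exact_mod_cast (show a < 2 * (a / 2) + 2 by omega)
  push_cast at h1 h2
  constructor <;> linarith

end RuleFiftyFour

open RuleFiftyFour in
theorem mainTheorem8 :
    -- the profile in terms of `r`, according to the parity of `x + t`
    (∀ (x : ℤ) (t : ℕ), Odd (x + t) → profile x t = r ((t - x + 1) / 2) t) ∧
    (∀ (x : ℤ) (t : ℕ), 1 ≤ t → Even (x + t) → profile x t = r ((t - x) / 2) (t - 1)) ∧
    -- outside of the light-cone
    (∀ (x : ℤ) (t : ℕ), x < -(t : ℤ) → profile x t = 1 / 2) ∧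
    (∀ (x : ℤ) (t : ℕ), (t : ℤ) < x → profile x t = 0) ∧
    -- the exact form of `r` inside the light-cone
    (∀ (m : ℤ) (t : ℕ), 1 ≤ m → m ≤ t →
      r m t =
        3 / 8 * (if m = t then 1 else 0)
        + 1 / 8 * ((if m = 1 ∧ t = 1 then 1 else 0) + (if m = 2 ∧ t = 2 then 1 else 0))
        + 1 / 4 * (if m = 3 ∧ t = 4 then 1 else 0)
        + (if 0 ≤ 2 * m - t - 3 then 1 else 0)
          * (2 : ℝ) ^ ((t : ℤ) - 2 * m - 1) * binom (2 * m - t - 3) (t - m - 1)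
        + 1 / 8 * ∑ y ∈ Finset.Icc ((t : ℤ) - m - 2) (2 * m - t - 3),
            (2 : ℝ) ^ (-(2 * m - t - 3)) * binom (2 * m - t - 3) y
        + 3 / 16 * ∑ y ∈ Finset.Icc (0 : ℤ) (2 * m - t - 3),
            (2 : ℝ) ^ (-y) * binom y (t - m - 1)
        + 1 / 2 * ∑ y ∈ Finset.Icc (0 : ℤ) (t - m - 1),
            (2 : ℝ) ^ (-(m - 1 - y)) * binom (m - 1 - y) y) ∧
    -- the section of the light-cone that is populated only by right-movers
    (∀ (x : ℤ) (t : ℕ), -(t : ℝ) / 3 < x → x ≤ t →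
      profile x t = 1 / 3 * (1 - (-1 / 2 : ℝ) ^ ⌊((t : ℝ) - x + 1) / 2⌋)) ∧
    -- the diffusive scale around `x / t = -1 / 2`
    (∀ (ζ : ℝ) (x : ℕ → ℤ),
      Tendsto (fun t : ℕ => ((x t : ℝ) + t / 2) / √(t : ℝ)) atTop (𝓝 ζ) →
      Tendsto (fun t : ℕ => profile (x t) t) atTop (𝓝 (1 / 12 * (5 - erf (2 * ζ))))) := by
  refine ⟨fun x t h => ?_, fun x t ht h => ?_, fun x t h => profile_left_of_lightcone h,
    fun x t h => profile_right_of_lightcone h, r_exact, fun x t h1 h2 => ?_, tendsto_profile⟩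
  · obtain ⟨c, hc⟩ := h
    exact profile_eq_r (by omega)
  · obtain ⟨u, rfl⟩ : ∃ u, t = u + 1 := ⟨t - 1, by omega⟩
    rw [profile_succ_of_even (by exact_mod_cast h), Nat.add_sub_cancel]
    obtain ⟨c, hc⟩ := h
    exact profile_eq_r (by omega)
  · have h1' : -(t : ℤ) < 3 * x := by
      have : -(t : ℝ) < 3 * x := by linarith
      exact_mod_cast this
    have hfl := floor_intCast_div_two ((t : ℤ) - x + 1)
    push_cast at hfl
    rw [hfl, profile_of_right_movers h1' h2]
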